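/- Let $\alpha\in(0,1)$, $N\in\mathbb N$ with $N>2\alpha$, and $2^*_\alpha:=\frac{2N}{N-2\alpha}$. Let $\mathcal D^{\alpha,2}(\mathbb R^N)$ be the completion of $C_c^\infty(\mathbb R^N)$ with respect to $$[u]:=\Big(\iint_{\mathbb R^{2N}}\frac{|u(x)-u(y)|^2}{|x-y|^{N+2\alpha}}\,dx\,dy\Big)^{1/2},$$ regarded as a space of functions modulo equality almost everywhere. Let $V,K:\mathbb R^N\to\mathbb R$ be continuous and positive, with $K\in L^\infty(\mathbb R^N)$, such that for every $R>0$ and every sequence $(A_n)$ of Borel sets of Lebesgue measure at most $R$, $\int_{A_n\setminus B_r(0)}K\,dx\to0$ as $r\to+\infty$, uniformly in $n$. Let $f:\mathbb R\to\mathbb R$ be continuous, put $F(t):=\int_0^tf(\tau)\,d\tau$, and suppose that at least one of the following holds: (A) $K/V\in L^\infty(\mathbb R^N)$ and $\lim_{t\to0}\frac{f(t)}{|t|}=0$; (B) for some $m\in(2,2^*_\alpha)$, $K(x)/V(x)^{\frac{2^*_\alpha-m}{2^*_\alpha-2}}\to0$ as $|x|\to+\infty$ and $\limsup_{t\to0}\frac{|f(t)|}{|t|^{m-1}}<+\infty$.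 Suppose also that $$\lim_{|t|\to\infty}\frac{f(t)}{|t|^{2^*_\alpha-1}}=0,\qquad \lim_{|t|\to\infty}\frac{F(t)}{|t|^2}=+\infty,$$ and that $t\mapsto f(t)/|t|$ is strictly increasing on $\mathbb R\setminus\{0\}$. Let $X:=\{u\in\mathcal D^{\alpha,2}(\mathbb R^N):\int_{\mathbb R^N} V|u|^2\,dx<\infty\}$, with $\|u\|:=\big([u]^2+\int_{\mathbb R^N} V|u|^2\,dx\big)^{1/2}$. For $u,\varphi\in X$ let $$J(u):=\tfrac12\|u\|^2-\int_{\mathbb R^N}K\,F(u)\,dx,$$ $$\langle J'(u),\varphi\rangle:=\iint_{\mathbb R^{2N}}\frac{(u(x)-u(y))(\varphi(x)-\varphi(y))}{|x-y|^{N+2\alpha}}\,dx\,dy+\int_{\mathbb R^N}Vu\varphi\,dx-\int_{\mathbb R^N}Kf(u)\varphi\,dx.$$ Write $u^+:=\max\{u,0\}$ and $u^-:=\min\{u,0\}$, and let $$\mathcal M:=\{w\in X\setminus\{0\}: w^+\ne0,\ w^-\neq0,\ \langle J'(w),w\rangle=\langle J'(w),w^+\rangle=\langle J'(w),w^-\rangle=0\}.$$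 Let $u\in X$ with $u^+\neq0$ and $u^-\ne0$, and for $t,s\ge0$ let $$h^u(t,s):=J(tu^++su^-),\qquad \Phi^u_1(t,s):=\langle J'(tu^++su^-),u^+\rangle,\qquad \Phi_2^u(t,s):=\langle J'(tu^++su^-),u^-\rangle.$$ Then $h^u$ is differentiable on $[0,\infty)\times[0,\infty)$ (relative to this set) with gradient $(\Phi^u_1,\Phi^u_2)$, and: (i) For $t,s\ge0$: $(t,s)$ is a critical point of $h^u$ with $t,s>0$ if and only if $tu^++su^-\in\mathcal M$. (ii) $h^u$ has exactly one critical point $(t_+,s_-)$ with $t_+>0$ and $s_->0$, and this point is the unique global maximum point of $h^u$ on $[0,\infty)\times[0,\infty)$. (iii) The functions $a_+(r):=\Phi^u_1(r,s_-)\,r$ and $a_-(r):=\Phi_2^u(t_+,r)\,r$ satisfy $a_+(r)>0$ for $0<r<t_+$, $a_+(r)<0$ for $r>t_+$, $a_-(r)>0$ for $0<r<s_-$, and $a_-(r)<0$ for $r>s_-$. -/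

import Mathlib

open MeasureTheory Filter Topology Asymptotics
open scoped ENNReal

namespace FracSchrodinger

/-- The Euclidean space `ℝᴺ`. -/
abbrev Rn (N : ℕ) : Type := EuclideanSpace ℝ (Fin N)

/-- The critical exponent `2N / (N - 2α)`. -/
noncomputable def critExp (α : ℝ) (N : ℕ) : ℝ := 2 * (N : ℝ) / ((N : ℝ) - 2 * α)

/-- The Gagliardo seminorm
`[u] = (∬ |u(x) - u(y)|² / |x - y|^(N + 2α) dx dy)^(1/2)`, with values in `[0, ∞]`. -/
noncomputable def gagliardo {N : ℕ} (α : ℝ) (u : Rn N → ℝ) : ℝ≥0∞ :=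
  (∫⁻ p : Rn N × Rn N,
    ENNReal.ofReal (|u p.1 - u p.2| ^ 2 / ‖p.1 - p.2‖ ^ ((N : ℝ) + 2 * α))) ^ (1 / 2 : ℝ)

/-- The bilinear form `∬ (u(x) - u(y)) (φ(x) - φ(y)) / |x - y|^(N + 2α) dx dy`. -/
noncomputable def gagliardoForm {N : ℕ} (α : ℝ) (u φ : Rn N → ℝ) : ℝ :=
  ∫ p : Rn N × Rn N,
    (u p.1 - u p.2) * (φ p.1 - φ p.2) / ‖p.1 - p.2‖ ^ ((N : ℝ) + 2 * α)

/-- Membership in `D^{α,2}(ℝᴺ)`, the completion of `C_c^∞(ℝᴺ)` for the Gagliardo seminorm,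
realised as a space of functions (modulo a.e. equality): `u` is the limit, in the seminorm and
almost everywhere, of test functions. The almost everywhere convergence fixes the additive
constant, which the seminorm does not see. -/
def MemD {N : ℕ} (α : ℝ) (u : Rn N → ℝ) : Prop :=
  ∃ φ : ℕ → Rn N → ℝ,
    (∀ n, ContDiff ℝ ((⊤ : ℕ∞) : WithTop ℕ∞) (φ n) ∧ HasCompactSupport (φ n)) ∧
    (∀ᵐ x, Tendsto (fun n => φ n x) atTop (𝓝 (u x))) ∧
    Tendsto (fun n => gagliardo α (fun x => φ n x - u x)) atTop (𝓝 0)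

/-- The space `X` of all `u ∈ D^{α,2}(ℝᴺ)` with `∫ V |u|² < ∞`. -/
def spaceX {N : ℕ} (α : ℝ) (V : Rn N → ℝ) : Set (Rn N → ℝ) :=
  {u | MemD α u ∧ Integrable (fun x => V x * |u x| ^ 2)}

/-- The norm of `X`. -/
noncomputable def normX {N : ℕ} (α : ℝ) (V : Rn N → ℝ) (u : Rn N → ℝ) : ℝ :=
  Real.sqrt ((gagliardo α u).toReal ^ 2 + ∫ x, V x * |u x| ^ 2)

/-- Two functions are identified when they agree a.e., so `u ≠ 0` means this. -/
def Nonzero {N : ℕ} (u : Rn N → ℝ) : Prop := ¬ (u =ᵐ[volume] fun _ => (0 : ℝ))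

/-- `u⁺ = max {u, 0}`. -/
noncomputable def pos {N : ℕ} (u : Rn N → ℝ) : Rn N → ℝ := fun x => max (u x) 0

/-- `u⁻ = min {u, 0}` (a nonpositive function, so that `u = u⁺ + u⁻`). -/
noncomputable def neg {N : ℕ} (u : Rn N → ℝ) : Rn N → ℝ := fun x => min (u x) 0

/-- The condition that `K / V` is essentially bounded. -/
def CondH3 {N : ℕ} (V K : Rn N → ℝ) : Prop :=
  MemLp (fun x => K x / V x) ⊤ volume

/-- The condition that `m ∈ (2, 2*)` and `K / V^((2* - m)/(2* - 2)) → 0` at infinity. -/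
def CondH4 {N : ℕ} (α m : ℝ) (V K : Rn N → ℝ) : Prop :=
  2 < m ∧ m < critExp α N ∧
    Tendsto (fun x => K x / V x ^ ((critExp α N - m) / (critExp α N - 2)))
      (cocompact (Rn N)) (𝓝 0)

/-- The class of admissible pairs of potentials. -/
structure ClassK {N : ℕ} (α : ℝ) (V K : Rn N → ℝ) : Prop where
  continuous_V : Continuous V
  continuous_K : Continuous K
  V_pos : ∀ x, 0 < V x
  K_pos : ∀ x, 0 < K x
  K_bounded : MemLp K ⊤ volume
  tail : ∀ (A : ℕ → Set (Rn N)) (R : ℝ), 0 < R → (∀ n, MeasurableSet (A n)) →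
    (∀ n, volume (A n) ≤ ENNReal.ofReal R) →
    TendstoUniformly (fun (r : ℝ) (n : ℕ) => ∫ x in A n ∩ (Metric.ball 0 r)ᶜ, K x)
      (fun _ => 0) atTop
  h3_or_h4 : CondH3 V K ∨ ∃ m, CondH4 α m V K

/-- The primitive `F(t) = ∫₀ᵗ f`. -/
noncomputable def primF (f : ℝ → ℝ) (t : ℝ) : ℝ := ∫ τ in (0 : ℝ)..t, f τ

/-- The assumptions on the nonlinearity `f`, including the behaviour at the origin, which depends
on which of the two alternatives holds for `(V, K)`. -/
structure CondF {N : ℕ} (α : ℝ) (V K : Rn N → ℝ) (f : ℝ → ℝ) : Prop where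
  continuous : Continuous f
  origin :
    (CondH3 V K ∧ Tendsto (fun t => f t / |t|) (𝓝[≠] 0) (𝓝 0)) ∨
    (∃ m, CondH4 α m V K ∧ f =O[𝓝[≠] 0] fun t => |t| ^ (m - 1))
  quasicritical :
    Tendsto (fun t => f t / |t| ^ (critExp α N - 1)) (cocompact ℝ) (𝓝 0)
  superquadratic : Tendsto (fun t => primF f t / |t| ^ 2) (cocompact ℝ) atTop
  increasing : StrictMonoOn (fun t => f t / |t|) {0}ᶜ

/-- The energy functional `J(u) = ‖u‖² / 2 - ∫ K F(u)`. -/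
noncomputable def energy {N : ℕ} (α : ℝ) (V K : Rn N → ℝ) (f : ℝ → ℝ) (u : Rn N → ℝ) : ℝ :=
  1 / 2 * normX α V u ^ 2 - ∫ x, K x * primF f (u x)

/-- The pairing `⟨J'(u), φ⟩`. -/
noncomputable def dEnergy {N : ℕ} (α : ℝ) (V K : Rn N → ℝ) (f : ℝ → ℝ)
    (u φ : Rn N → ℝ) : ℝ :=
  gagliardoForm α u φ + (∫ x, V x * u x * φ x) - ∫ x, K x * f (u x) * φ x

/-- The Nehari manifold. -/
def nehari {N : ℕ} (α : ℝ) (V K : Rn N → ℝ) (f : ℝ → ℝ) : Set (Rn N → ℝ) :=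
  {u | u ∈ spaceX α V ∧ Nonzero u ∧ dEnergy α V K f u u = 0}

/-- The nodal set `M`. -/
def nodal {N : ℕ} (α : ℝ) (V K : Rn N → ℝ) (f : ℝ → ℝ) : Set (Rn N → ℝ) :=
  {w | w ∈ nehari α V K f ∧ Nonzero (pos w) ∧ Nonzero (neg w) ∧
    dEnergy α V K f w (pos w) = 0 ∧ dEnergy α V K f w (neg w) = 0}

/-- The function `t u⁺ + s u⁻`. -/
noncomputable def comb {N : ℕ} (u : Rn N → ℝ) (t s : ℝ) : Rn N → ℝ :=
  fun x => t * pos u x + s * neg u x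

/-- `h^u(t, s) = J(t u⁺ + s u⁻)`; it is studied on the quadrant `[0, ∞) × [0, ∞)`. -/
noncomputable def hFun {N : ℕ} (α : ℝ) (V K : Rn N → ℝ) (f : ℝ → ℝ) (u : Rn N → ℝ)
    (p : ℝ × ℝ) : ℝ :=
  energy α V K f (comb u p.1 p.2)

/-- The closed quadrant `[0, ∞) × [0, ∞)`. -/
def quadrant : Set (ℝ × ℝ) := Set.Ici 0 ×ˢ Set.Ici 0

/-- `p` is a critical point of `h` on the quadrant: `h` is differentiable there with derivative
zero. At points with positive coordinates this is ordinary differentiability. -/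
def IsCritical (h : ℝ × ℝ → ℝ) (p : ℝ × ℝ) : Prop :=
  HasFDerivWithinAt h (0 : ℝ × ℝ →L[ℝ] ℝ) quadrant p

/-- `Φ₁^u(t, s) = ⟨J'(t u⁺ + s u⁻), u⁺⟩`. -/
noncomputable def Phi1 {N : ℕ} (α : ℝ) (V K : Rn N → ℝ) (f : ℝ → ℝ) (u : Rn N → ℝ)
    (t s : ℝ) : ℝ :=
  dEnergy α V K f (comb u t s) (pos u)

/-- `Φ₂^u(t, s) = ⟨J'(t u⁺ + s u⁻), u⁻⟩`. -/
noncomputable def Phi2 {N : ℕ} (α : ℝ) (V K : Rn N → ℝ) (f : ℝ → ℝ) (u : Rn N → ℝ)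
    (t s : ℝ) : ℝ :=
  dEnergy α V K f (comb u t s) (neg u)

end FracSchrodinger

open FracSchrodinger

/-!
Since `u⁺` and `u⁻` have disjoint supports, `J` on the plane they span is
`(a t² + b s²) / 2 + c t s - G₊(t) - G₋(s)`, with `c = ⟨u⁺, u⁻⟩ ≥ 0` and
`G±(t) = ∫ K F(t u±)`. Averaging over `x` preserves the assumptions on `f`: the derivatives
`g±` of `G±` are again superquadratic, negligible at the origin, and have increasing quotients
`g±(t) / |t|`. Superquadraticity makes the function tend to `-∞` on the quadrant, so it has a
maximum, and the behaviour at the origin and `c ≥ 0` push it off the axes. At a critical point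
`g₊(t) / t = a + c s / t` and `g₋(s) / s = b + c t / s`, so of two critical points in the interior
the one with the larger `s / t` would have the larger `t` and the smaller `s`: it is unique.

The integrals exist by the fractional Sobolev inequality. It is obtained by comparing `u x` with
the values of `u` on a ball around `x` so large that `|u| ≤ |u x| / 2` on half of it.
-/

namespace FracSchrodinger

section DiffQuotient

variable {N : ℕ} {α : ℝ} {u v : Rn N → ℝ}

/-- The fractional difference quotient of `u`. The exponent is half of that of the Gagliardo
kernel, so that the seminorm `[u]` is the `L²` norm of `diffQuotient α u` on `ℝᴺ × ℝᴺ`. -/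
noncomputable def diffQuotient (α : ℝ) (u : Rn N → ℝ) (p : Rn N × Rn N) : ℝ :=
  (u p.1 - u p.2) / ‖p.1 - p.2‖ ^ (((N : ℝ) + 2 * α) / 2)

theorem diffQuotient_add :
    diffQuotient α (u + v) = diffQuotient α u + diffQuotient α v := by
  ext p
  simp only [diffQuotient, Pi.add_apply]
  ring

theorem diffQuotient_smul (c : ℝ) : diffQuotient α (c • u) = c • diffQuotient α u := by
  ext p
  simp only [diffQuotient, Pi.smul_apply, smul_eq_mul]
  ring

theorem diffQuotient_sub :
    diffQuotient α (u - v) = diffQuotient α u - diffQuotient α v := by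
  ext p
  simp only [diffQuotient, Pi.sub_apply]
  ring

theorem abs_diffQuotient_le_of_abs_sub_le {w : Rn N → ℝ} {p : Rn N × Rn N}
    (h : |u p.1 - u p.2| ≤ |v p.1 - v p.2| + |w p.1 - w p.2|) :
    |diffQuotient α u p| ≤ |diffQuotient α v p| + |diffQuotient α w p| := by
  simp only [diffQuotient, abs_div]
  rw [← add_div]
  gcongr

theorem diffQuotient_mul_diffQuotient (p : Rn N × Rn N) :
    diffQuotient α u p * diffQuotient α v p =
      (u p.1 - u p.2) * (v p.1 - v p.2) / ‖p.1 - p.2‖ ^ ((N : ℝ) + 2 * α) := by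
  rw [diffQuotient, diffQuotient, div_mul_div_comm, ← pow_two, ← Real.rpow_mul_natCast
    (norm_nonneg _), Nat.cast_two, div_mul_cancel₀ _ two_ne_zero]

theorem gagliardoForm_eq_integral :
    gagliardoForm α u v = ∫ p, diffQuotient α u p * diffQuotient α v p :=
  integral_congr_ae <| .of_forall fun p => (diffQuotient_mul_diffQuotient p).symm

theorem enorm_diffQuotient_sq (p : Rn N × Rn N) :
    ‖diffQuotient α u p‖ₑ ^ (2 : ℝ) =
      ENNReal.ofReal (|u p.1 - u p.2| ^ 2 / ‖p.1 - p.2‖ ^ ((N : ℝ) + 2 * α)) := by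
  rw [Real.enorm_eq_ofReal_abs, ENNReal.ofReal_rpow_of_nonneg (abs_nonneg _) zero_le_two,
    Real.rpow_two, sq_abs, sq, diffQuotient_mul_diffQuotient, ← sq, sq_abs]

theorem gagliardo_eq_eLpNorm : gagliardo α u = eLpNorm (diffQuotient α u) 2 := by
  rw [eLpNorm_eq_lintegral_rpow_enorm_toReal two_ne_zero ENNReal.ofNat_ne_top, gagliardo]
  simp only [ENNReal.toReal_ofNat, enorm_diffQuotient_sq]

theorem aestronglyMeasurable_diffQuotient (hu : AEStronglyMeasurable u) :
    AEStronglyMeasurable (diffQuotient α u) := by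
  have hfst : AEStronglyMeasurable fun p : Rn N × Rn N => u p.1 := by
    rw [Measure.volume_eq_prod]
    exact hu.comp_fst
  have hsnd : AEStronglyMeasurable fun p : Rn N × Rn N => u p.2 := by
    rw [Measure.volume_eq_prod]
    exact hu.comp_snd
  exact ((hfst.sub hsnd).aemeasurable.div (by fun_prop)).aestronglyMeasurable

theorem ae_tendsto_diffQuotient {φ : ℕ → Rn N → ℝ}
    (h : ∀ᵐ x, Tendsto (fun n => φ n x) atTop (𝓝 (u x))) :
    ∀ᵐ p, Tendsto (fun n => diffQuotient α (φ n) p) atTop (𝓝 (diffQuotient α u p)) := by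
  rw [Measure.volume_eq_prod]
  filter_upwards [Measure.quasiMeasurePreserving_fst.ae h,
    Measure.quasiMeasurePreserving_snd.ae h] with p h₁ h₂
  exact (h₁.sub h₂).div_const _

theorem integrable_min_one_sq_div_rpow (hα0 : 0 < α) (hα1 : α < 1) (hN : 0 < N) :
    Integrable fun z : Rn N => min 1 (‖z‖ ^ 2) / ‖z‖ ^ ((N : ℝ) + 2 * α) := by
  have : Nonempty (Fin N) := ⟨⟨0, hN⟩⟩
  have hN1 : ((N - 1 : ℕ) : ℝ) = N - 1 := by rw [Nat.cast_sub hN, Nat.cast_one]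
  refine (integrable_fun_norm_addHaar (E := Rn N) volume
    (f := fun r => min 1 (r ^ 2) / r ^ ((N : ℝ) + 2 * α))).2 ?_
  rw [finrank_euclideanSpace_fin, ← Set.Ioc_union_Ioi_eq_Ioi (zero_le_one' ℝ), integrableOn_union]
  constructor
  · have hpow : IntegrableOn (fun r : ℝ => r ^ (1 - 2 * α)) (Set.Ioc 0 1) := by
      rw [← intervalIntegrable_iff_integrableOn_Ioc_of_le zero_le_one]
      exact intervalIntegral.intervalIntegrable_rpow' (by linarith)
    refine hpow.congr_fun (fun r ⟨hr0, hr1⟩ => ?_) measurableSet_Ioc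
    rw [min_eq_right (pow_le_one₀ hr0.le hr1), smul_eq_mul, mul_div_assoc', ← Real.rpow_natCast,
      ← Real.rpow_natCast, ← Real.rpow_add hr0, ← Real.rpow_sub hr0, hN1]
    ring_nf
  · have hpow : IntegrableOn (fun r : ℝ => r ^ (-1 - 2 * α)) (Set.Ioi 1) :=
      integrableOn_Ioi_rpow_of_lt (by linarith) one_pos
    refine hpow.congr_fun (fun r hr => ?_) measurableSet_Ioi
    rw [min_eq_left (one_le_pow₀ (le_of_lt hr)), smul_eq_mul, mul_one_div, ← Real.rpow_natCast,
      ← Real.rpow_sub (one_pos.trans hr), hN1]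
    ring_nf

theorem exists_diffQuotient_sq_le {L : NNReal} (hL : LipschitzWith L u)
    (hc : HasCompactSupport u) :
    ∃ C : ℝ, 0 ≤ C ∧ ∀ p : Rn N × Rn N, diffQuotient α u p ^ 2 ≤
      C * (min 1 (‖p.1 - p.2‖ ^ 2) / ‖p.1 - p.2‖ ^ ((N : ℝ) + 2 * α)) := by
  obtain ⟨M, hM⟩ := hc.exists_bound_of_continuous hL.continuous
  simp only [Real.norm_eq_abs] at hM
  refine ⟨max (L : ℝ) (2 * M) ^ 2, by positivity, fun p => ?_⟩
  have hlip : |u p.1 - u p.2| ≤ L * ‖p.1 - p.2‖ := hL.norm_sub_le p.1 p.2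
  have hbdd : |u p.1 - u p.2| ≤ 2 * M := by
    linarith [abs_sub (u p.1) (u p.2), hM p.1, hM p.2]
  rw [sq, diffQuotient_mul_diffQuotient, ← sq, ← sq_abs, mul_div_assoc']
  gcongr
  rw [mul_min_of_nonneg _ _ (by positivity), mul_one, ← mul_pow]
  refine le_min ?_ ?_ <;> gcongr
  · exact hbdd.trans (le_max_right _ _)
  · exact hlip.trans (by gcongr; exact le_max_left _ _)

theorem memLp_diffQuotient_of_lipschitzWith (hα0 : 0 < α) (hα1 : α < 1) (hN : 0 < N)
    {L : NNReal} (hL : LipschitzWith L u) (hc : HasCompactSupport u) :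
    MemLp (diffQuotient α u) 2 := by
  set κ : Rn N → ℝ := fun z => min 1 (‖z‖ ^ 2) / ‖z‖ ^ ((N : ℝ) + 2 * α)
  obtain ⟨C, hC, hbound⟩ : ∃ C : ℝ, 0 ≤ C ∧ ∀ p : Rn N × Rn N,
      diffQuotient α u p ^ 2 ≤ C * κ (p.1 - p.2) := exists_diffQuotient_sq_le hL hc
  have hκ : Integrable κ := integrable_min_one_sq_div_rpow hα0 hα1 hN
  have hκ_symm (x y : Rn N) : κ (x - y) = κ (y - x) := by simp only [κ, norm_sub_rev x y]
  set χ : Rn N → ℝ := (tsupport u).indicator 1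
  have hχ : Integrable χ := (integrable_indicator_iff (isClosed_tsupport u).measurableSet).2
    (integrableOn_const (hs := hc.measure_lt_top.ne))
  have hχ_snd : Integrable fun p : Rn N × Rn N => χ p.2 * κ (p.1 - p.2) :=
    hχ.convolution_integrand (ContinuousLinearMap.mul ℝ ℝ) hκ
  have hχ_fst : Integrable fun p : Rn N × Rn N => χ p.1 * κ (p.1 - p.2) :=
    hχ_snd.swap.congr <| .of_forall fun p => by
      simp only [Function.comp_apply, Prod.fst_swap, Prod.snd_swap, hκ_symm p.2]
  have hQ := aestronglyMeasurable_diffQuotient (α := α) hL.continuous.aestronglyMeasurable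
  rw [memLp_two_iff_integrable_sq hQ]
  refine ((hχ_fst.add hχ_snd).const_mul C).mono' (hQ.pow 2) (.of_forall fun p => ?_)
  have hκ0 : 0 ≤ κ (p.1 - p.2) := by positivity
  have hχ0 (x : Rn N) : 0 ≤ χ x := Set.indicator_nonneg (fun _ _ => zero_le_one) x
  rw [Real.norm_of_nonneg (sq_nonneg _), Pi.add_apply]
  by_cases h₁ : p.1 ∈ tsupport u
  · have : χ p.1 = 1 := Set.indicator_of_mem h₁ 1
    refine (hbound p).trans (mul_le_mul_of_nonneg_left ?_ hC)
    rw [this, one_mul]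
    exact le_add_of_nonneg_right (mul_nonneg (hχ0 _) hκ0)
  by_cases h₂ : p.2 ∈ tsupport u
  · have : χ p.2 = 1 := Set.indicator_of_mem h₂ 1
    refine (hbound p).trans (mul_le_mul_of_nonneg_left ?_ hC)
    rw [this, one_mul]
    exact le_add_of_nonneg_left (mul_nonneg (hχ0 _) hκ0)
  · rw [diffQuotient, image_eq_zero_of_notMem_tsupport h₁, image_eq_zero_of_notMem_tsupport h₂,
      sub_zero, zero_div, sq, zero_mul]
    have := hχ0 p.1
    have := hχ0 p.2
    positivity

end DiffQuotient

section Sobolev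

variable {N : ℕ} {α : ℝ} {u : Rn N → ℝ}

theorem two_lt_critExp (hα0 : 0 < α) (hN : 2 * α < N) : 2 < critExp α N := by
  rw [critExp, lt_div_iff₀ (by linarith)]
  linarith

theorem critExp_pos (hα0 : 0 < α) (hN : 2 * α < N) : 0 < critExp α N :=
  two_pos.trans (two_lt_critExp hα0 hN)

theorem critExp_mul (hα0 : 0 < α) (hN : 2 * α < N) :
    critExp α N * (2 * α / N) = critExp α N - 2 := by
  have hN0 : (N : ℝ) ≠ 0 := by linarith
  have : (N : ℝ) - 2 * α ≠ 0 := by linarith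
  rw [critExp]
  field_simp
  ring

theorem mul_volume_ball_le_lintegral_diffQuotient (hα0 : 0 < α) (hu : AEStronglyMeasurable u)
    {x : Rn N} {r : ℝ} (hx : u x ≠ 0)
    (hr : volume {y | |u x| / 2 ≤ |u y|} ≤ volume (Metric.ball x r) / 2) :
    ENNReal.ofReal ((|u x| / 2) ^ 2 / r ^ ((N : ℝ) + 2 * α)) * (volume (Metric.ball x r) / 2) ≤
      ∫⁻ y, ‖diffQuotient α u (x, y)‖ₑ ^ (2 : ℝ) := by
  set T := {y | |u x| / 2 ≤ |u y|}
  set S := Metric.ball x r \ T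
  have hS : NullMeasurableSet S := measurableSet_ball.nullMeasurableSet.diff <|
    nullMeasurableSet_le aemeasurable_const hu.aemeasurable.abs
  have hvol : volume (Metric.ball x r) / 2 ≤ volume S := by
    rw [← ENNReal.sub_half measure_ball_lt_top.ne]
    exact (tsub_le_tsub_left hr _).trans le_measure_sdiff
  have hlow (y : Rn N) (hy : y ∈ S) :
      ENNReal.ofReal ((|u x| / 2) ^ 2 / r ^ ((N : ℝ) + 2 * α)) ≤
        ‖diffQuotient α u (x, y)‖ₑ ^ (2 : ℝ) := by
    obtain ⟨hball, hsmall : ¬ |u x| / 2 ≤ |u y|⟩ := hy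
    rw [Metric.mem_ball', dist_eq_norm] at hball
    have hne : x ≠ y := by
      rintro rfl
      linarith [abs_pos.2 hx]
    have : 0 < ‖x - y‖ := norm_pos_iff.2 (sub_ne_zero.2 hne)
    rw [enorm_diffQuotient_sq]
    gcongr
    linarith [abs_sub_abs_le_abs_sub (u x) (u y)]
  calc _ ≤ ∫⁻ _ in S, ENNReal.ofReal ((|u x| / 2) ^ 2 / r ^ ((N : ℝ) + 2 * α)) := by
        rw [setLIntegral_const]
        gcongr
    _ ≤ ∫⁻ y in S, ‖diffQuotient α u (x, y)‖ₑ ^ (2 : ℝ) :=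
        lintegral_mono_ae ((ae_restrict_mem₀ hS).mono hlow)
    _ ≤ _ := setLIntegral_le_lintegral _ _

theorem measure_le_abs_le_of_eLpNorm_eq {X : Type*} [MeasurableSpace X] {μ : Measure X}
    {g : X → ℝ} {p M a : ℝ} (hp : 0 < p) (hg : AEStronglyMeasurable g μ) (ha : 0 < a)
    (hM0 : 0 ≤ M) (hM : eLpNorm g (ENNReal.ofReal p) μ = ENNReal.ofReal M) :
    μ {x | a ≤ |g x|} ≤ ENNReal.ofReal ((M / a) ^ p) := by
  have hcheb := meas_ge_le_mul_pow_eLpNorm_enorm μ (ENNReal.ofReal_pos.2 hp).ne'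
    ENNReal.ofReal_ne_top hg (ENNReal.ofReal_pos.2 ha).ne' (by simp)
  simp only [Real.enorm_eq_ofReal_abs, ENNReal.ofReal_le_ofReal_iff (abs_nonneg _)] at hcheb
  refine hcheb.trans_eq ?_
  rw [ENNReal.toReal_ofReal hp.le, hM, ← ENNReal.mul_rpow_of_nonneg _ _ hp.le, mul_comm,
    ← div_eq_mul_inv, ← ENNReal.ofReal_div_of_pos ha,
    ENNReal.ofReal_rpow_of_nonneg (by positivity) hp.le]

/-- With `r` chosen so that `v r ^ N = 2 (2 M / a) ^ 2*`, the lower bound for the Gagliardo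
integral over a ball of radius `r` becomes a multiple of `a ^ 2*`. -/
theorem sq_div_radius_rpow_mul_eq (hα0 : 0 < α) (hN : 2 * α < N) {a M v r : ℝ} (ha : 0 < a)
    (hM : 0 < M) (hv : 0 < v) (hr : r = (2 * (2 * M / a) ^ critExp α N / v) ^ (1 / N : ℝ)) :
    (a / 2) ^ 2 / r ^ ((N : ℝ) + 2 * α) * (2 * M / a) ^ critExp α N =
      v / 8 * (v / 2) ^ (2 * α / N) * 2 ^ (2 - critExp α N) * M ^ (2 - critExp α N) *
        a ^ critExp α N := by
  have hN0 : (N : ℝ) ≠ 0 := by linarith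
  set P := critExp α N
  set q := (2 * M / a) ^ P
  have hr0 : 0 < r := hr ▸ by positivity
  have hrN : r ^ (N : ℝ) = 2 * q / v := by
    rw [hr, ← Real.rpow_mul (by positivity), one_div_mul_cancel hN0, Real.rpow_one]
  have hrα : r ^ (2 * α) = q ^ (2 * α / N) / (v / 2) ^ (2 * α / N) := by
    rw [← Real.div_rpow (by positivity) (by positivity), hr, ← Real.rpow_mul (by positivity)]
    congr 1 <;> field_simp
  have hqα : q ^ (2 * α / N) = (2 * M) ^ (P - 2) / a ^ (P - 2) := by
    rw [← Real.rpow_mul (by positivity), critExp_mul hα0 hN,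
      Real.div_rpow (by positivity) ha.le]
  have haP : a ^ P = a ^ 2 * a ^ (P - 2) := by
    rw [← Real.rpow_two, ← Real.rpow_add ha, add_sub_cancel]
  have hMP : (2 * M) ^ (P - 2) = (2 ^ (2 - P) * M ^ (2 - P))⁻¹ := by
    rw [← Real.mul_rpow zero_le_two hM.le, ← Real.rpow_neg (by positivity), neg_sub]
  rw [Real.rpow_add hr0, hrN, hrα, hqα, haP, hMP]
  have : 0 < (v / 2) ^ (2 * α / N) := by positivity
  have : 0 < a ^ (P - 2) := by positivity
  have : 0 < q := by positivity
  field_simp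
  norm_num

theorem exists_mul_rpow_le_lintegral_diffQuotient (hα0 : 0 < α) (hN : 2 * α < N) :
    ∃ c : ℝ, 0 < c ∧ ∀ u : Rn N → ℝ, AEStronglyMeasurable u → ∀ M : ℝ, 0 < M →
      eLpNorm u (ENNReal.ofReal (critExp α N)) = ENNReal.ofReal M → ∀ x,
        ENNReal.ofReal (c * M ^ (2 - critExp α N) * |u x| ^ critExp α N) ≤
          ∫⁻ y, ‖diffQuotient α u (x, y)‖ₑ ^ (2 : ℝ) := by
  have hP0 : 0 < critExp α N := critExp_pos hα0 hN
  have hN0 : (N : ℝ) ≠ 0 := by linarith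
  set v := volume.real (Metric.ball (0 : Rn N) 1)
  have hv : 0 < v := ENNReal.toReal_pos (Metric.measure_ball_pos _ _ one_pos).ne'
    measure_ball_lt_top.ne
  refine ⟨v / 8 * (v / 2) ^ (2 * α / N) * 2 ^ (2 - critExp α N), by positivity,
    fun u hu M hM0 hM x => ?_⟩
  rcases eq_or_ne (u x) 0 with hx | hx
  · simp [hx, Real.zero_rpow hP0.ne']
  have ha : 0 < |u x| := abs_pos.2 hx
  set q := (2 * M / |u x|) ^ critExp α N
  set r := (2 * q / v) ^ (1 / N : ℝ) with hr
  have hball : volume (Metric.ball x r) / 2 = ENNReal.ofReal q := by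
    rw [Measure.addHaar_ball_of_pos _ _ (by positivity), finrank_euclideanSpace_fin,
      ← Real.rpow_natCast, ← Real.rpow_mul (by positivity), one_div_mul_cancel hN0, Real.rpow_one,
      ← ofReal_measureReal measure_ball_lt_top.ne, ← ENNReal.ofReal_mul (by positivity),
      div_mul_cancel₀ _ hv.ne', ENNReal.ofReal_mul zero_le_two, ENNReal.ofReal_ofNat, mul_comm,
      ENNReal.mul_div_cancel_right two_ne_zero ENNReal.ofNat_ne_top]
  have hcheb : volume {y | |u x| / 2 ≤ |u y|} ≤ ENNReal.ofReal q := by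
    convert measure_le_abs_le_of_eLpNorm_eq hP0 hu (half_pos ha) hM0.le hM using 3
    field_simp
  rw [← sq_div_radius_rpow_mul_eq hα0 hN ha hM0 hv hr, ENNReal.ofReal_mul (by positivity), ← hball]
  exact mul_volume_ball_le_lintegral_diffQuotient hα0 hu hx (hcheb.trans_eq hball.symm)

theorem gagliardo_rpow_two (hu : AEStronglyMeasurable u) :
    gagliardo α u ^ (2 : ℝ) = ∫⁻ x, ∫⁻ y, ‖diffQuotient α u (x, y)‖ₑ ^ (2 : ℝ) := by
  have hmeas := (aestronglyMeasurable_diffQuotient (α := α) hu).enorm.pow_const (2 : ℝ)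
  rw [Measure.volume_eq_prod] at hmeas
  rw [gagliardo, ← ENNReal.rpow_mul, one_div_mul_cancel two_ne_zero, ENNReal.rpow_one,
    Measure.volume_eq_prod]
  simp only [← enorm_diffQuotient_sq]
  exact lintegral_prod _ hmeas

theorem exists_eLpNorm_critExp_le_gagliardo (hα0 : 0 < α) (hN : 2 * α < N) :
    ∃ C : NNReal, ∀ u : Rn N → ℝ, MemLp u (ENNReal.ofReal (critExp α N)) →
      eLpNorm u (ENNReal.ofReal (critExp α N)) ≤ C * gagliardo α u := by
  obtain ⟨c, hc, hle⟩ := exists_mul_rpow_le_lintegral_diffQuotient hα0 hN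
  have hP0 : 0 < critExp α N := critExp_pos hα0 hN
  refine ⟨(√c)⁻¹.toNNReal, fun u hu => ?_⟩
  obtain ⟨M, hM0, hM⟩ : ∃ M : ℝ, 0 ≤ M ∧
      eLpNorm u (ENNReal.ofReal (critExp α N)) = ENNReal.ofReal M :=
    ⟨(eLpNorm u _).toReal, ENNReal.toReal_nonneg, by
      rw [ENNReal.ofReal_toReal hu.eLpNorm_ne_top]⟩
  rcases hM0.eq_or_lt with hM0 | hM0
  · simp [hM, ← hM0]
  have h_int : ∫⁻ x, ENNReal.ofReal (|u x| ^ critExp α N) = ENNReal.ofReal (M ^ critExp α N) := by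
    rw [← ENNReal.ofReal_rpow_of_pos hM0, ← hM, eLpNorm_eq_lintegral_rpow_enorm_toReal
      (ENNReal.ofReal_pos.2 hP0).ne' ENNReal.ofReal_ne_top, ENNReal.toReal_ofReal hP0.le,
      ← ENNReal.rpow_mul, one_div_mul_cancel hP0.ne', ENNReal.rpow_one]
    simp only [Real.enorm_eq_ofReal_abs, ENNReal.ofReal_rpow_of_nonneg (abs_nonneg _) hP0.le]
  have hsq : ENNReal.ofReal (√c * M) ^ (2 : ℝ) ≤ gagliardo α u ^ (2 : ℝ) := by
    calc ENNReal.ofReal (√c * M) ^ (2 : ℝ)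
        = ENNReal.ofReal (c * M ^ (2 - critExp α N)) * ENNReal.ofReal (M ^ critExp α N) := by
          rw [← ENNReal.ofReal_mul (by positivity), mul_assoc, ← Real.rpow_add hM0,
            sub_add_cancel, ENNReal.ofReal_rpow_of_nonneg (by positivity) zero_le_two,
            Real.mul_rpow (by positivity) hM0.le, Real.rpow_two, Real.sq_sqrt hc.le]
      _ = ∫⁻ x, ENNReal.ofReal (c * M ^ (2 - critExp α N) * |u x| ^ critExp α N) := by
          simp only [ENNReal.ofReal_mul (by positivity : 0 ≤ c * M ^ (2 - critExp α N))]
          rw [lintegral_const_mul' _ _ ENNReal.ofReal_ne_top, h_int]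
      _ ≤ ∫⁻ x, ∫⁻ y, ‖diffQuotient α u (x, y)‖ₑ ^ (2 : ℝ) :=
          lintegral_mono (hle u hu.1 M hM0 hM)
      _ = gagliardo α u ^ (2 : ℝ) := (gagliardo_rpow_two hu.1).symm
  rw [ENNReal.rpow_le_rpow_iff two_pos] at hsq
  have heq : eLpNorm u (ENNReal.ofReal (critExp α N))
      = ENNReal.ofReal (√c)⁻¹ * ENNReal.ofReal (√c * M) := by
    rw [hM, ← ENNReal.ofReal_mul (by positivity), inv_mul_cancel_left₀ (by positivity)]
  rw [heq]
  exact mul_le_mul_right hsq _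

end Sobolev

section Dominated

variable {X : Type*} [MeasurableSpace X] {μ : Measure X} {p : ℝ≥0∞} {F G : ℕ → X → ℝ} {B : X → ℝ}

theorem tendsto_eLpNorm_zero_of_abs_le (hp0 : p ≠ 0) (hp : p ≠ ⊤)
    (hF : ∀ n, AEStronglyMeasurable (F n) μ) (hB : MemLp B p μ) (hle : ∀ n x, |F n x| ≤ |B x|)
    (hlim : ∀ᵐ x ∂μ, Tendsto (fun n => F n x) atTop (𝓝 0)) :
    Tendsto (fun n => eLpNorm (F n) p μ) atTop (𝓝 0) := by
  have hp_pos : 0 < p.toReal := ENNReal.toReal_pos hp0 hp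
  have h_int : Tendsto (fun n => ∫⁻ x, ‖F n x‖ₑ ^ p.toReal ∂μ) atTop (𝓝 (∫⁻ _, 0 ∂μ)) := by
    refine tendsto_lintegral_of_dominated_convergence' _
      (fun n => (hF n).enorm.pow_const _) (fun n => .of_forall fun x => ?_)
      (lintegral_rpow_enorm_lt_top_of_eLpNorm_lt_top hp0 hp hB.2).ne (hlim.mono fun x hx => ?_)
    · exact ENNReal.rpow_le_rpow (enorm_le_iff_norm_le.2 (hle n x)) hp_pos.le
    · simpa only [enorm_zero, ENNReal.zero_rpow_of_pos hp_pos] using hx.enorm.ennrpow_const p.toReal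
  simp only [eLpNorm_eq_lintegral_rpow_enorm_toReal hp0 hp]
  simpa only [lintegral_zero, ENNReal.zero_rpow_of_pos (one_div_pos.2 hp_pos)] using
    h_int.ennrpow_const (1 / p.toReal)

theorem tendsto_eLpNorm_zero_of_abs_le_add (hp1 : 1 ≤ p) (hp : p ≠ ⊤)
    (hF : ∀ n, AEStronglyMeasurable (F n) μ) (hG : ∀ n, AEStronglyMeasurable (G n) μ)
    (hB : MemLp B p μ) (hle : ∀ n x, |F n x| ≤ |G n x| + |B x|)
    (hG0 : Tendsto (fun n => eLpNorm (G n) p μ) atTop (𝓝 0))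
    (hlim : ∀ᵐ x ∂μ, Tendsto (fun n => F n x) atTop (𝓝 0)) :
    Tendsto (fun n => eLpNorm (F n) p μ) atTop (𝓝 0) := by
  set E : ℕ → X → ℝ := fun n x => max (|F n x| - |G n x|) 0
  have hE_meas (n : ℕ) : AEStronglyMeasurable (E n) μ :=
    ((hF n).norm.sub (hG n).norm).sup aestronglyMeasurable_const
  have hE : Tendsto (fun n => eLpNorm (E n) p μ) atTop (𝓝 0) := by
    refine tendsto_eLpNorm_zero_of_abs_le (one_pos.trans_le hp1).ne' hp hE_meas hB (fun n x => ?_)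
      (hlim.mono fun x hx => ?_)
    · rw [abs_of_nonneg (le_max_right _ _)]
      exact max_le (sub_le_iff_le_add'.2 (hle n x)) (abs_nonneg _)
    · refine squeeze_zero (fun n => le_max_right _ _) (fun n => ?_)
        ((tendsto_zero_iff_abs_tendsto_zero _).1 hx)
      exact max_le (sub_le_self _ (abs_nonneg _)) (abs_nonneg _)
  refine tendsto_of_tendsto_of_tendsto_of_le_of_le tendsto_const_nhds
    (by simpa only [add_zero] using hG0.add hE) (fun _ => zero_le) fun n => ?_
  rw [← eLpNorm_norm (G n)]
  refine (eLpNorm_mono_real fun x => ?_).trans (eLpNorm_add_le (hG n).norm (hE_meas n) hp1)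
  exact sub_le_iff_le_add'.1 (le_max_left _ _)

end Dominated

section MemD

variable {N : ℕ} {α : ℝ} {u v w : Rn N → ℝ}

theorem MemD.aestronglyMeasurable (hu : MemD α u) : AEStronglyMeasurable u := by
  obtain ⟨φ, hφ, hlim, -⟩ := hu
  exact aestronglyMeasurable_of_tendsto_ae atTop
    (fun n => (hφ n).1.continuous.aestronglyMeasurable) hlim

theorem MemD.memLp_diffQuotient (hα0 : 0 < α) (hα1 : α < 1) (hN : 2 * α < N) (hu : MemD α u) :
    MemLp (diffQuotient α u) 2 := by
  have hN0 : 0 < N := by exact_mod_cast (mul_pos two_pos hα0).trans hN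
  have hu_meas := hu.aestronglyMeasurable
  obtain ⟨φ, hφ, -, hgag⟩ := hu
  obtain ⟨n, hn⟩ := (hgag.eventually_lt_const ENNReal.zero_lt_top).exists
  obtain ⟨L, hL⟩ := ContDiff.lipschitzWith_of_hasCompactSupport (hφ n).2 (hφ n).1 (by simp)
  have hφQ : MemLp (diffQuotient α (φ n)) 2 :=
    memLp_diffQuotient_of_lipschitzWith hα0 hα1 hN0 hL (hφ n).2
  have hdiff : MemLp (diffQuotient α (φ n - u)) 2 :=
    ⟨aestronglyMeasurable_diffQuotient (hL.continuous.aestronglyMeasurable.sub hu_meas),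
      gagliardo_eq_eLpNorm.symm.trans_lt hn⟩
  rw [← sub_sub_cancel (φ n) u, diffQuotient_sub]
  exact hφQ.sub hdiff

theorem gagliardo_add_le (hu : AEStronglyMeasurable u) (hv : AEStronglyMeasurable v) :
    gagliardo α (u + v) ≤ gagliardo α u + gagliardo α v := by
  simp only [gagliardo_eq_eLpNorm, diffQuotient_add]
  exact eLpNorm_add_le (aestronglyMeasurable_diffQuotient hu) (aestronglyMeasurable_diffQuotient hv)
    one_le_two

theorem exists_eLpNorm_critExp_le_gagliardo_of_memD (hα0 : 0 < α) (hN : 2 * α < N) :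
    ∃ C : NNReal, ∀ u : Rn N → ℝ, MemD α u →
      eLpNorm u (ENNReal.ofReal (critExp α N)) ≤ C * gagliardo α u := by
  obtain ⟨C, hC⟩ := exists_eLpNorm_critExp_le_gagliardo hα0 hN
  refine ⟨C, fun u hu => ?_⟩
  have hu_meas := hu.aestronglyMeasurable
  obtain ⟨φ, hφ, hlim, hgag⟩ := hu
  replace hgag : Tendsto (fun n => gagliardo α (φ n - u)) atTop (𝓝 0) := hgag
  have hφ_meas (n : ℕ) : AEStronglyMeasurable (φ n) := (hφ n).1.continuous.aestronglyMeasurable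
  have hbound (n : ℕ) : eLpNorm (φ n) (ENNReal.ofReal (critExp α N)) ≤
      C * (gagliardo α (φ n - u) + gagliardo α u) := by
    refine (hC _ ((hφ n).1.continuous.memLp_of_hasCompactSupport (hφ n).2)).trans ?_
    gcongr
    conv_lhs => rw [← sub_add_cancel (φ n) u]
    exact gagliardo_add_le ((hφ_meas n).sub hu_meas) hu_meas
  have hgag' : Tendsto (fun n => C * (gagliardo α (φ n - u) + gagliardo α u)) atTop
      (𝓝 (C * gagliardo α u)) := by
    simpa only [zero_add] using
      ENNReal.Tendsto.const_mul (hgag.add_const (gagliardo α u)) (.inr ENNReal.coe_ne_top)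
  rw [← hgag'.liminf_eq]
  exact (Lp.eLpNorm_lim_le_liminf_eLpNorm hφ_meas u hlim).trans
    (liminf_le_liminf (.of_forall hbound))

theorem MemD.memLp_critExp (hα0 : 0 < α) (hα1 : α < 1) (hN : 2 * α < N) (hu : MemD α u) :
    MemLp u (ENNReal.ofReal (critExp α N)) := by
  obtain ⟨C, hC⟩ := exists_eLpNorm_critExp_le_gagliardo_of_memD hα0 hN
  refine ⟨hu.aestronglyMeasurable, (hC u hu).trans_lt (ENNReal.mul_lt_top ENNReal.coe_lt_top ?_)⟩
  rw [gagliardo_eq_eLpNorm]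
  exact (hu.memLp_diffQuotient hα0 hα1 hN).2

theorem MemD.gagliardo_pos (hα0 : 0 < α) (hN : 2 * α < N) (hu : MemD α u) (h0 : Nonzero u) :
    0 < gagliardo α u := by
  obtain ⟨C, hC⟩ := exists_eLpNorm_critExp_le_gagliardo_of_memD hα0 hN
  refine pos_iff_ne_zero.2 fun hzero => h0 ?_
  have hP0 : ENNReal.ofReal (critExp α N) ≠ 0 := (ENNReal.ofReal_pos.2 (critExp_pos hα0 hN)).ne'
  rw [← Pi.zero_def, ← eLpNorm_eq_zero_iff hu.aestronglyMeasurable hP0, ← nonpos_iff_eq_zero]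
  simpa only [hzero, mul_zero] using hC u hu

theorem MemD.add (hu : MemD α u) (hv : MemD α v) : MemD α (u + v) := by
  have hu_meas := hu.aestronglyMeasurable
  have hv_meas := hv.aestronglyMeasurable
  obtain ⟨φ, hφ, hφ_lim, hφ_gag⟩ := hu
  obtain ⟨ψ, hψ, hψ_lim, hψ_gag⟩ := hv
  refine ⟨φ + ψ, fun n => ⟨(hφ n).1.add (hψ n).1, (hφ n).2.add (hψ n).2⟩, ?_, ?_⟩
  · filter_upwards [hφ_lim, hψ_lim] with x hx hy using hx.add hy
  refine tendsto_of_tendsto_of_tendsto_of_le_of_le tendsto_const_nhds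
    (by simpa only [add_zero] using hφ_gag.add hψ_gag) (fun _ => zero_le) fun n => ?_
  change gagliardo α (φ n + ψ n - (u + v)) ≤ gagliardo α (φ n - u) + gagliardo α (ψ n - v)
  rw [add_sub_add_comm]
  exact gagliardo_add_le ((hφ n).1.continuous.aestronglyMeasurable.sub hu_meas)
    ((hψ n).1.continuous.aestronglyMeasurable.sub hv_meas)

theorem MemD.const_smul (hu : MemD α u) (c : ℝ) : MemD α (c • u) := by
  obtain ⟨φ, hφ, hlim, hgag⟩ := hu
  replace hgag : Tendsto (fun n => gagliardo α (φ n - u)) atTop (𝓝 0) := hgag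
  refine ⟨fun n => c • φ n, fun n => ⟨(hφ n).1.const_smul c, (hφ n).2.smul_left⟩,
    hlim.mono fun x hx => hx.const_smul c, ?_⟩
  have heq (n : ℕ) : gagliardo α (fun x => (c • φ n) x - (c • u) x) =
      ‖c‖ₑ * gagliardo α (φ n - u) := by
    change gagliardo α (c • φ n - c • u) = _
    rw [← smul_sub, gagliardo_eq_eLpNorm, gagliardo_eq_eLpNorm, diffQuotient_smul,
      eLpNorm_const_smul]
  simp only [heq]
  simpa only [mul_zero] using ENNReal.Tendsto.const_mul hgag (.inr enorm_ne_top)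

/-- The smooth approximation `√(τ² + ε²) - ε` of `|τ|`, shifted so as to vanish at the origin and
hence to preserve compact supports. -/
noncomputable def smoothAbs (ε τ : ℝ) : ℝ := √(τ ^ 2 + ε ^ 2) - ε

theorem contDiff_smoothAbs {ε : ℝ} (hε : 0 < ε) {n : WithTop ℕ∞} : ContDiff ℝ n (smoothAbs ε) := by
  have : ContDiff ℝ n fun τ : ℝ => √(τ ^ 2 + ε ^ 2) :=
    ContDiff.sqrt (by fun_prop) fun τ => by positivity
  exact this.sub contDiff_const

theorem smoothAbs_apply_zero {ε : ℝ} (hε : 0 < ε) : smoothAbs ε 0 = 0 := by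
  simp [smoothAbs, Real.sqrt_sq hε.le]

theorem abs_smoothAbs_sub_le (ε a b : ℝ) : |smoothAbs ε a - smoothAbs ε b| ≤ |a - b| := by
  rw [smoothAbs, smoothAbs, sub_sub_sub_cancel_right, ← Complex.norm_add_mul_I,
    ← Complex.norm_add_mul_I]
  refine (abs_norm_sub_norm_le _ _).trans_eq ?_
  rw [add_sub_add_right_eq_sub, ← Complex.ofReal_sub, Complex.norm_real, Real.norm_eq_abs]

theorem tendsto_smoothAbs {ε τ : ℕ → ℝ} {a : ℝ} (hε : Tendsto ε atTop (𝓝 0))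
    (hτ : Tendsto τ atTop (𝓝 a)) :
    Tendsto (fun n => smoothAbs (ε n) (τ n)) atTop (𝓝 |a|) := by
  have hcont : Continuous fun q : ℝ × ℝ => smoothAbs q.1 q.2 := by
    simp only [smoothAbs]
    fun_prop
  simpa [Function.comp_def, smoothAbs, Real.sqrt_sq_eq_abs] using
    (hcont.tendsto (0, a)).comp (hε.prodMk_nhds hτ)

theorem MemD.abs (hα0 : 0 < α) (hα1 : α < 1) (hN : 2 * α < N) (hu : MemD α u) :
    MemD α fun x => |u x| := by
  have hu_meas := hu.aestronglyMeasurable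
  have huQ := hu.memLp_diffQuotient hα0 hα1 hN
  obtain ⟨φ, hφ, hlim, hgag⟩ := hu
  set ε : ℕ → ℝ := fun n => 1 / ((n : ℝ) + 1)
  have hε (n : ℕ) : 0 < ε n := by positivity
  set ψ : ℕ → Rn N → ℝ := fun n x => smoothAbs (ε n) (φ n x)
  have hψ (n : ℕ) : ContDiff ℝ ((⊤ : ℕ∞) : WithTop ℕ∞) (ψ n) :=
    (contDiff_smoothAbs (hε n)).comp (hφ n).1
  have hψ_lim : ∀ᵐ x, Tendsto (fun n => ψ n x) atTop (𝓝 |u x|) :=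
    hlim.mono fun x hx => tendsto_smoothAbs tendsto_one_div_add_atTop_nhds_zero_nat hx
  refine ⟨ψ, fun n => ⟨hψ n, (hφ n).2.comp_left (smoothAbs_apply_zero (hε n))⟩, hψ_lim, ?_⟩
  have hle (n : ℕ) (p : Rn N × Rn N) : |diffQuotient α (fun x => ψ n x - |u x|) p| ≤
      |diffQuotient α (φ n - u) p| + |diffQuotient α ((2 : ℝ) • u) p| := by
    refine abs_diffQuotient_le_of_abs_sub_le ?_
    have hψ_le : |ψ n p.1 - ψ n p.2| ≤ |φ n p.1 - φ n p.2| := abs_smoothAbs_sub_le _ _ _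
    have habs : |(|u p.1| - |u p.2|)| ≤ |u p.1 - u p.2| := abs_abs_sub_abs_le_abs_sub _ _
    have hφ_le : |φ n p.1 - φ n p.2| ≤
        |(φ n - u) p.1 - (φ n - u) p.2| + |u p.1 - u p.2| := by
      refine (abs_add_le _ _).trans_eq' ?_
      rw [Pi.sub_apply, Pi.sub_apply, sub_sub_sub_comm, sub_add_cancel]
    calc |ψ n p.1 - |u p.1| - (ψ n p.2 - |u p.2|)|
        ≤ |ψ n p.1 - ψ n p.2| + |(|u p.1| - |u p.2|)| := by
          rw [sub_sub_sub_comm]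
          exact abs_sub _ _
      _ ≤ |(φ n - u) p.1 - (φ n - u) p.2| + 2 * |u p.1 - u p.2| := by linarith
      _ = _ := by rw [Pi.smul_apply, Pi.smul_apply, ← smul_sub, smul_eq_mul, abs_mul, abs_two]
  simp only [gagliardo_eq_eLpNorm] at hgag ⊢
  refine tendsto_eLpNorm_zero_of_abs_le_add one_le_two ENNReal.ofNat_ne_top
    (fun n => aestronglyMeasurable_diffQuotient
      ((hψ n).continuous.aestronglyMeasurable.sub hu_meas.norm))
    (fun n => aestronglyMeasurable_diffQuotient
      ((hφ n).1.continuous.aestronglyMeasurable.sub hu_meas))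
    (by rw [diffQuotient_smul]; exact huQ.const_smul 2) hle hgag ?_
  have : ∀ᵐ x, Tendsto (fun n => ψ n x - |u x|) atTop (𝓝 0) :=
    hψ_lim.mono fun x hx => by simpa only [sub_self] using hx.sub_const |u x|
  simpa [diffQuotient] using ae_tendsto_diffQuotient (α := α) (u := 0) this

theorem toReal_gagliardo_sq (hu : MemLp (diffQuotient α u) 2) :
    (gagliardo α u).toReal ^ 2 = gagliardoForm α u u := by
  rw [gagliardo_eq_eLpNorm, gagliardoForm_eq_integral, toReal_eLpNorm hu.1,
    lpNorm_eq_integral_norm_rpow_toReal two_ne_zero ENNReal.ofNat_ne_top hu.1,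
    ENNReal.toReal_ofNat, ← Real.rpow_two, ← Real.rpow_mul (by positivity),
    inv_mul_cancel₀ two_ne_zero, Real.rpow_one]
  simp only [Real.rpow_two, Real.norm_eq_abs, sq_abs]
  simp only [sq]

theorem gagliardoForm_comm : gagliardoForm α u v = gagliardoForm α v u := by
  simp only [gagliardoForm, mul_comm]

theorem gagliardoForm_add_left (hu : MemLp (diffQuotient α u) 2)
    (hv : MemLp (diffQuotient α v) 2) (hw : MemLp (diffQuotient α w) 2) :
    gagliardoForm α (u + v) w = gagliardoForm α u w + gagliardoForm α v w := by
  simp only [gagliardoForm_eq_integral, diffQuotient_add, Pi.add_apply, add_mul]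
  exact integral_add (hu.integrable_mul hw) (hv.integrable_mul hw)

theorem gagliardoForm_smul_left (c : ℝ) : gagliardoForm α (c • u) v = c * gagliardoForm α u v := by
  simp only [gagliardoForm_eq_integral, diffQuotient_smul, Pi.smul_apply, smul_eq_mul, mul_assoc,
    integral_const_mul]

end MemD

section Nehari

/-- The nonlinearities for which the fibering (Nehari manifold) method applies: continuous,
sublinear at the origin, with superquadratic primitive, and with `f t / |t|` strictly
increasing. -/
structure NehariNonlinearity (f : ℝ → ℝ) : Prop where
  continuous : Continuous f
  origin : Tendsto (fun t => f t / |t|) (𝓝[≠] 0) (𝓝 0)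
  superquadratic : Tendsto (fun t => primF f t / |t| ^ 2) (cocompact ℝ) atTop
  increasing : StrictMonoOn (fun t => f t / |t|) {0}ᶜ

theorem primF_const_mul_comp_mul (f : ℝ → ℝ) (k v t : ℝ) :
    primF (fun t => k * f (t * v) * v) t = k * primF f (t * v) := by
  have h := intervalIntegral.smul_integral_comp_mul_right (a := 0) (b := t) f v
  rw [zero_mul, smul_eq_mul] at h
  simp only [primF, mul_assoc k, intervalIntegral.integral_const_mul,
    intervalIntegral.integral_mul_const, ← h, mul_comm v]

namespace NehariNonlinearity

variable {f : ℝ → ℝ}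

theorem map_zero (hf : NehariNonlinearity f) : f 0 = 0 := by
  have habs : Tendsto (fun t : ℝ => |t|) (𝓝[≠] 0) (𝓝 0) := by
    simpa using (continuous_abs.tendsto (0 : ℝ)).mono_left nhdsWithin_le_nhds
  have hlim : Tendsto f (𝓝[≠] 0) (𝓝 (0 * 0)) := by
    refine (hf.origin.mul habs).congr' ?_
    filter_upwards [self_mem_nhdsWithin] with t ht using div_mul_cancel₀ _ (abs_ne_zero.2 ht)
  simpa using tendsto_nhds_unique (hf.continuous.continuousWithinAt (x := 0)) hlim

-- At `t = 0` the quotient `f t / |t|` is `0` by convention, which is also its limit there.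
theorem strictMono_div_abs (hf : NehariNonlinearity f) : StrictMono fun t => f t / |t| := by
  intro a b hab
  rcases eq_or_ne a 0 with rfl | ha
  · have hb : 0 < b / 2 := half_pos hab
    have hle : 0 ≤ f (b / 2) / |b / 2| := by
      refine le_of_tendsto (hf.origin.mono_left (nhdsGT_le_nhdsNE (0 : ℝ))) ?_
      filter_upwards [Ioo_mem_nhdsGT hb] with s hs
      exact (hf.increasing hs.1.ne' hb.ne' hs.2).le
    simpa using hle.trans_lt (hf.increasing hb.ne' hab.ne' (half_lt_self hab))
  rcases eq_or_ne b 0 with rfl | hb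
  · have ha2 : a / 2 < 0 := by linarith
    have hle : f (a / 2) / |a / 2| ≤ 0 := by
      refine ge_of_tendsto (hf.origin.mono_left (nhdsLT_le_nhdsNE (0 : ℝ))) ?_
      filter_upwards [Ioo_mem_nhdsLT ha2] with s hs
      exact (hf.increasing ha2.ne hs.2.ne hs.1).le
    simpa using (hf.increasing ha ha2.ne (by linarith)).trans_le hle
  exact hf.increasing ha hb hab

theorem div_abs_mul_abs (hf : NehariNonlinearity f) (t : ℝ) : f t / |t| * |t| = f t := by
  rcases eq_or_ne t 0 with rfl | ht
  · simp [hf.map_zero]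
  · exact div_mul_cancel₀ _ (abs_ne_zero.2 ht)

theorem nonneg_of_nonneg (hf : NehariNonlinearity f) {t : ℝ} (ht : 0 ≤ t) : 0 ≤ f t := by
  rw [← hf.div_abs_mul_abs]
  have := hf.strictMono_div_abs.monotone ht
  exact mul_nonneg (by simpa using this) (abs_nonneg t)

theorem nonpos_of_nonpos (hf : NehariNonlinearity f) {t : ℝ} (ht : t ≤ 0) : f t ≤ 0 := by
  rw [← hf.div_abs_mul_abs]
  have := hf.strictMono_div_abs.monotone ht
  exact mul_nonpos_of_nonpos_of_nonneg (by simpa using this) (abs_nonneg t)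

theorem monotone (hf : NehariNonlinearity f) : Monotone f := by
  intro a b hab
  have hslope : f a / |a| ≤ f b / |b| := hf.strictMono_div_abs.monotone hab
  rcases le_total 0 a with ha | ha
  · have := div_nonneg (hf.nonneg_of_nonneg ha) (abs_nonneg a)
    rw [← hf.div_abs_mul_abs a, ← hf.div_abs_mul_abs b]
    gcongr
    exact this.trans hslope
  rcases le_total 0 b with hb | hb
  · exact (hf.nonpos_of_nonpos ha).trans (hf.nonneg_of_nonneg hb)
  · have hb' := div_nonpos_of_nonpos_of_nonneg (hf.nonpos_of_nonpos hb) (abs_nonneg b)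
    rw [← hf.div_abs_mul_abs a, ← hf.div_abs_mul_abs b]
    exact (mul_le_mul_of_nonneg_right hslope (abs_nonneg a)).trans
      (mul_le_mul_of_nonpos_left (abs_le_abs_of_nonpos hb hab) hb')

theorem mul_self_nonneg (hf : NehariNonlinearity f) (t : ℝ) : 0 ≤ f t * t := by
  rcases le_total 0 t with ht | ht
  · exact mul_nonneg (hf.nonneg_of_nonneg ht) ht
  · exact mul_nonneg_of_nonpos_of_nonpos (hf.nonpos_of_nonpos ht) ht

theorem hasDerivAt_primF (hf : NehariNonlinearity f) (t : ℝ) : HasDerivAt (primF f) (f t) t :=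
  intervalIntegral.integral_hasDerivAt_right (hf.continuous.intervalIntegrable _ _)
    (hf.continuous.stronglyMeasurableAtFilter _ _) hf.continuous.continuousAt

theorem continuous_primF (hf : NehariNonlinearity f) : Continuous (primF f) :=
  continuous_iff_continuousAt.2 fun t => (hf.hasDerivAt_primF t).continuousAt

theorem convexOn_primF (hf : NehariNonlinearity f) : ConvexOn ℝ Set.univ (primF f) := by
  refine Monotone.convexOn_univ_of_deriv (fun t => (hf.hasDerivAt_primF t).differentiableAt) ?_
  rw [show deriv (primF f) = f from funext fun t => (hf.hasDerivAt_primF t).deriv]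
  exact hf.monotone

theorem tangent_le_primF (hf : NehariNonlinearity f) (t s : ℝ) :
    primF f t + f t * (s - t) ≤ primF f s := by
  rcases lt_trichotomy t s with hts | rfl | hts
  · have h := hf.convexOn_primF.le_slope_of_hasDerivAt trivial trivial hts (hf.hasDerivAt_primF t)
    rw [slope_def_field, le_div_iff₀ (sub_pos.2 hts)] at h
    linarith
  · simp
  · have h := hf.convexOn_primF.slope_le_of_hasDerivAt trivial trivial hts (hf.hasDerivAt_primF t)
    rw [slope_def_field, div_le_iff₀ (sub_pos.2 hts)] at h
    linarith

theorem primF_nonneg (hf : NehariNonlinearity f) (t : ℝ) : 0 ≤ primF f t := by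
  simpa [primF, hf.map_zero] using hf.tangent_le_primF 0 t

theorem primF_le_mul_self (hf : NehariNonlinearity f) (t : ℝ) : primF f t ≤ f t * t := by
  have h := hf.tangent_le_primF t 0
  simp only [primF, zero_sub, intervalIntegral.integral_same] at h ⊢
  linarith

theorem const_mul_comp_mul (hf : NehariNonlinearity f) {k v : ℝ}
    (hk : 0 < k) (hv : v ≠ 0) : NehariNonlinearity fun t => k * f (t * v) * v := by
  have hslope (t : ℝ) : k * f (t * v) * v / |t| = k * |v| * (f (t * v) / |t * v| * v) := by
    rw [abs_mul]
    field [abs_ne_zero.2 hv]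
  have hv0 : 0 < |v| := abs_pos.2 hv
  refine ⟨by have := hf.continuous; fun_prop, ?_, ?_, ?_⟩
  · have hmul : Tendsto (fun t : ℝ => t * v) (𝓝[≠] 0) (𝓝[≠] 0) := by
      refine tendsto_nhdsWithin_iff.2 ⟨?_, ?_⟩
      · simpa using ((continuous_mul_const v).tendsto 0).mono_left nhdsWithin_le_nhds
      · filter_upwards [self_mem_nhdsWithin] with t ht using mul_ne_zero ht hv
    simpa only [hslope, zero_mul, mul_zero, Function.comp_apply] using
      ((hf.origin.comp hmul).mul_const v).const_mul (k * |v|)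
  · have hmul : Tendsto (fun t : ℝ => t * v) (cocompact ℝ) (cocompact ℝ) :=
      (Homeomorph.mulRight₀ v hv).isClosedEmbedding.tendsto_cocompact
    refine ((hf.superquadratic.comp hmul).const_mul_atTop
      (mul_pos hk (pow_pos hv0 2))).congr fun t => ?_
    rw [primF_const_mul_comp_mul, Function.comp_apply, abs_mul]
    field
  · refine StrictMono.strictMonoOn (fun a b hab => ?_) _
    simp only [hslope]
    refine mul_lt_mul_of_pos_left ?_ (by positivity)
    rcases hv.lt_or_gt with hv | hv
    · exact mul_lt_mul_of_neg_right
        (hf.strictMono_div_abs (mul_lt_mul_of_neg_right hab hv)) hv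
    · exact mul_lt_mul_of_pos_right
        (hf.strictMono_div_abs (mul_lt_mul_of_pos_right hab hv)) hv

section Average

variable {X : Type*} [MeasurableSpace X] {μ : Measure X} {φ : X → ℝ → ℝ}

theorem integrable_primF (hφ : ∀ᵐ x ∂μ, NehariNonlinearity (φ x))
    (h_int : ∀ t, Integrable (fun x => φ x t) μ)
    (hmeas : ∀ t, AEStronglyMeasurable (fun x => primF (φ x) t) μ) (t : ℝ) :
    Integrable (fun x => primF (φ x) t) μ := by
  refine ((h_int t).mul_const t).mono' (hmeas t) ?_
  filter_upwards [hφ] with x hx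
  rw [Real.norm_of_nonneg (hx.primF_nonneg t)]
  exact hx.primF_le_mul_self t

theorem exists_integrable_bound
    (hφ : ∀ᵐ x ∂μ, NehariNonlinearity (φ x)) (h_int : ∀ t, Integrable (fun x => φ x t) μ) (t : ℝ) :
    ∃ g : X → ℝ, Integrable g μ ∧ ∀ᵐ x ∂μ, ∀ s ∈ Metric.ball t 1, ‖φ x s‖ ≤ g x := by
  refine ⟨_, (h_int (t - 1)).abs.sup (h_int (t + 1)).abs, ?_⟩
  filter_upwards [hφ] with x hx s hs
  rw [Real.ball_eq_Ioo] at hs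
  exact abs_le_max_abs_abs (hx.monotone hs.1.le) (hx.monotone hs.2.le)

theorem continuous_integral
    (hφ : ∀ᵐ x ∂μ, NehariNonlinearity (φ x)) (h_int : ∀ t, Integrable (fun x => φ x t) μ) :
    Continuous fun t => ∫ x, φ x t ∂μ := by
  refine continuous_iff_continuousAt.2 fun t => ?_
  obtain ⟨g, hg, hbound⟩ := exists_integrable_bound hφ h_int t
  refine continuousAt_of_dominated (Eventually.of_forall fun s => (h_int s).aestronglyMeasurable)
    ?_ hg (hφ.mono fun x hx => hx.continuous.continuousAt)
  filter_upwards [Metric.ball_mem_nhds t one_pos] with s hs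
  filter_upwards [hbound] with x hx using hx s hs

theorem primF_integral (hφ : ∀ᵐ x ∂μ, NehariNonlinearity (φ x))
    (h_int : ∀ t, Integrable (fun x => φ x t) μ)
    (hmeas : ∀ t, AEStronglyMeasurable (fun x => primF (φ x) t) μ) (t : ℝ) :
    primF (fun t => ∫ x, φ x t ∂μ) t = ∫ x, primF (φ x) t ∂μ := by
  have hderiv (s : ℝ) : HasDerivAt (fun t => ∫ x, primF (φ x) t ∂μ) (∫ x, φ x s ∂μ) s := by
    obtain ⟨g, hg, hbound⟩ := exists_integrable_bound hφ h_int s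
    exact (hasDerivAt_integral_of_dominated_loc_of_deriv_le (Metric.ball_mem_nhds s one_pos)
      (Eventually.of_forall hmeas)
      (integrable_primF hφ h_int hmeas s) (h_int s).aestronglyMeasurable
      hbound hg (hφ.mono fun x hx r _ => hx.hasDerivAt_primF r)).2
  have hcont := continuous_integral hφ h_int
  rw [primF, intervalIntegral.integral_eq_sub_of_hasDerivAt (fun s _ => hderiv s)
    (hcont.intervalIntegrable 0 t)]
  simp [primF]

theorem tendsto_integral_div_abs
    (hφ : ∀ᵐ x ∂μ, NehariNonlinearity (φ x)) (h_int : ∀ t, Integrable (fun x => φ x t) μ) :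
    Tendsto (fun t => (∫ x, φ x t ∂μ) / |t|) (𝓝[≠] 0) (𝓝 0) := by
  have hlim : Tendsto (fun t => ∫ x, φ x t / |t| ∂μ) (𝓝[≠] 0) (𝓝 (∫ _, 0 ∂μ)) := by
    refine tendsto_integral_filter_of_dominated_convergence _
      (Eventually.of_forall fun t => ((h_int t).div_const _).aestronglyMeasurable) ?_
      ((h_int (-1)).abs.sup (h_int 1).abs) (hφ.mono fun x hx => hx.origin)
    filter_upwards [nhdsWithin_le_nhds (Icc_mem_nhds neg_one_lt_zero one_pos)] with t ht
    filter_upwards [hφ] with x hx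
    have hmono := hx.strictMono_div_abs.monotone
    simpa [abs_div] using abs_le_max_abs_abs (hmono ht.1) (hmono ht.2)
  simpa only [integral_div, integral_zero] using hlim

theorem tendsto_integral_primF_div_sq [NeZero μ]
    (hφ : ∀ᵐ x ∂μ, NehariNonlinearity (φ x)) (h_int : ∀ t, Integrable (fun x => φ x t) μ)
    (hmeas : ∀ t, AEStronglyMeasurable (fun x => primF (φ x) t) μ) :
    Tendsto (fun t => (∫ x, primF (φ x) t ∂μ) / |t| ^ 2) (cocompact ℝ) atTop := by
  have : IsCountablyGenerated (cocompact ℝ) := by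
    rw [cocompact_eq_atBot_atTop]
    infer_instance
  have hfatou := lintegral_liminf_le' (μ := μ) (u := cocompact ℝ)
    (f := fun t x => ENNReal.ofReal (primF (φ x) t / |t| ^ 2))
    fun t => ((hmeas t).aemeasurable.div_const _).ennreal_ofReal
  have htop : ∫⁻ x, liminf (fun t => ENNReal.ofReal (primF (φ x) t / |t| ^ 2)) (cocompact ℝ) ∂μ
      = ⊤ := by
    rw [lintegral_congr_ae (g := fun _ => ⊤) (hφ.mono fun x hx =>
      (ENNReal.tendsto_ofReal_nhds_top.2 hx.superquadratic).liminf_eq)]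
    simp [NeZero.ne μ]
  rw [htop, top_le_iff] at hfatou
  refine ENNReal.tendsto_ofReal_nhds_top.1 ?_
  refine tendsto_of_le_liminf_of_limsup_le (hfatou.ge.trans_eq ?_) le_top
  congr! 2 with t
  have hnonneg : ∀ᵐ x ∂μ, 0 ≤ primF (φ x) t / |t| ^ 2 :=
    hφ.mono fun x hx => div_nonneg (hx.primF_nonneg t) (by positivity)
  rw [← integral_div, ofReal_integral_eq_lintegral_ofReal
    ((integrable_primF hφ h_int hmeas t).div_const _) hnonneg]

theorem strictMono_integral_div_abs [NeZero μ]
    (hφ : ∀ᵐ x ∂μ, NehariNonlinearity (φ x)) (h_int : ∀ t, Integrable (fun x => φ x t) μ) :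
    StrictMono fun t => (∫ x, φ x t ∂μ) / |t| := by
  intro a b hab
  simp only [← integral_div]
  have hlt : ∀ᵐ x ∂μ, φ x a / |a| < φ x b / |b| := hφ.mono fun x hx => hx.strictMono_div_abs hab
  have ha := (h_int a).div_const |a|
  have hb := (h_int b).div_const |b|
  refine (integral_mono_ae ha hb (hlt.mono fun x => le_of_lt)).lt_of_ne fun heq => ?_
  have hae := (integral_eq_iff_of_ae_le ha hb (hlt.mono fun x => le_of_lt)).1 heq
  obtain ⟨x, hx, hx'⟩ := (hlt.and hae).exists
  exact hx.ne hx'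

theorem integral [NeZero μ] (hφ : ∀ᵐ x ∂μ, NehariNonlinearity (φ x))
    (h_int : ∀ t, Integrable (fun x => φ x t) μ)
    (hmeas : ∀ t, AEStronglyMeasurable (fun x => primF (φ x) t) μ) :
    NehariNonlinearity fun t => ∫ x, φ x t ∂μ where
  continuous := continuous_integral hφ h_int
  origin := tendsto_integral_div_abs hφ h_int
  superquadratic := by
    simp only [primF_integral hφ h_int hmeas]
    exact tendsto_integral_primF_div_sq hφ h_int hmeas
  increasing := (strictMono_integral_div_abs hφ h_int).strictMonoOn _

variable {K v : X → ℝ}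

theorem integral_const_mul_comp_mul (hf : NehariNonlinearity f)
    (hK : AEStronglyMeasurable K μ) (hK0 : ∀ x, 0 < K x) (hv : AEStronglyMeasurable v μ)
    (hv0 : ¬ v =ᵐ[μ] fun _ => (0 : ℝ))
    (h_int : ∀ t, Integrable (fun x => K x * f (t * v x) * v x) μ) :
    NehariNonlinearity (fun t => ∫ x, K x * f (t * v x) * v x ∂μ) ∧
      ∀ t, primF (fun t => ∫ x, K x * f (t * v x) * v x ∂μ) t =
        ∫ x, K x * primF f (t * v x) ∂μ := by
  set E := Function.support v
  have hE : NullMeasurableSet E μ :=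
    hv.aemeasurable.nullMeasurable (measurableSet_singleton (0 : ℝ)).compl
  have : NeZero (μ.restrict E) :=
    ⟨fun h => hv0 (measure_eq_zero_iff_ae_notMem.1 (Measure.restrict_eq_zero.1 h) |>.mono
      fun x hx => Function.notMem_support.1 hx)⟩
  have hφ : ∀ᵐ x ∂μ.restrict E, NehariNonlinearity fun t => K x * f (t * v x) * v x := by
    filter_upwards [ae_restrict_mem₀ hE] with x hx using hf.const_mul_comp_mul (hK0 x) hx
  have hmeas (t : ℝ) : AEStronglyMeasurable (fun x => primF (fun t => K x * f (t * v x) * v x) t)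
      (μ.restrict E) := by
    simp only [primF_const_mul_comp_mul]
    exact (hK.mul (hf.continuous_primF.comp_aestronglyMeasurable (hv.const_mul t))).restrict
  have hf_supp (t : ℝ) : ∫ x in E, K x * f (t * v x) * v x ∂μ = ∫ x, K x * f (t * v x) * v x ∂μ :=
    setIntegral_eq_integral_of_forall_compl_eq_zero fun x hx => by
      simp [Function.notMem_support.1 hx]
  have hF_supp (t : ℝ) : ∫ x in E, K x * primF f (t * v x) ∂μ = ∫ x, K x * primF f (t * v x) ∂μ :=
    setIntegral_eq_integral_of_forall_compl_eq_zero fun x hx => by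
      simp [Function.notMem_support.1 hx, primF]
  have h_int' (t : ℝ) := (h_int t).restrict (s := E)
  simp only [← hf_supp, ← hF_supp]
  refine ⟨.integral hφ h_int' hmeas, fun t => ?_⟩
  simp only [primF_integral hφ h_int' hmeas, primF_const_mul_comp_mul]

end Average

end NehariNonlinearity

end Nehari

section FiberMap

/-- The restriction of an energy `‖u‖² / 2 - ∫ F(u)` to a plane spanned by two vectors on which
the nonlinear term splits: `a` and `b` are the squared norms of the vectors, `c` is their inner
product, and `f`, `g` are the derivatives of the nonlinear term along them. -/
noncomputable def fiberMap (a b c : ℝ) (f g : ℝ → ℝ) (p : ℝ × ℝ) : ℝ :=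
  1 / 2 * (a * p.1 ^ 2 + b * p.2 ^ 2) + c * p.1 * p.2 - primF f p.1 - primF g p.2

/-- The partial derivative of `fiberMap a b c f g` in its first variable; the one in the second
variable is `fiberPartial b c g`, with the arguments exchanged. -/
def fiberPartial (a c : ℝ) (f : ℝ → ℝ) (t s : ℝ) : ℝ := a * t + c * s - f t

variable {a b c t s r : ℝ} {f g : ℝ → ℝ}

theorem fiberMap_swap (a b c : ℝ) (f g : ℝ → ℝ) (p : ℝ × ℝ) :
    fiberMap b a c g f p.swap = fiberMap a b c f g p := by
  simp only [fiberMap, Prod.fst_swap, Prod.snd_swap]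
  ring

theorem hasFDerivAt_fiberMap (a b c : ℝ) (hf : NehariNonlinearity f) (hg : NehariNonlinearity g)
    (t s : ℝ) :
    HasFDerivAt (fiberMap a b c f g)
      (fiberPartial a c f t s • ContinuousLinearMap.fst ℝ ℝ ℝ +
        fiberPartial b c g s t • ContinuousLinearMap.snd ℝ ℝ ℝ) (t, s) := by
  have hfst : HasFDerivAt Prod.fst (ContinuousLinearMap.fst ℝ ℝ ℝ) (t, s) := hasFDerivAt_fst
  have hsnd : HasFDerivAt Prod.snd (ContinuousLinearMap.snd ℝ ℝ ℝ) (t, s) := hasFDerivAt_snd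
  have hF := (hf.hasDerivAt_primF t).comp_hasFDerivAt (t, s) hfst
  have hG := (hg.hasDerivAt_primF s).comp_hasFDerivAt (t, s) hsnd
  have hquad := ((((hfst.pow 2).const_mul a).add ((hsnd.pow 2).const_mul b)).const_mul
    (1 / 2)).add ((hfst.const_mul c).mul hsnd)
  refine ((hquad.sub hF).sub hG).congr_fderiv ?_
  ext <;> simp [fiberPartial] <;> ring

theorem smul_fst_add_smul_snd_eq_zero_iff {x y : ℝ} :
    x • ContinuousLinearMap.fst ℝ ℝ ℝ + y • ContinuousLinearMap.snd ℝ ℝ ℝ = 0 ↔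
      x = 0 ∧ y = 0 := by
  refine ⟨fun h => ⟨?_, ?_⟩, fun ⟨hx, hy⟩ => by simp [hx, hy]⟩
  · simpa using DFunLike.congr_fun h ((1 : ℝ), (0 : ℝ))
  · simpa using DFunLike.congr_fun h ((0 : ℝ), (1 : ℝ))

theorem isCritical_fiberMap_iff (hf : NehariNonlinearity f) (hg : NehariNonlinearity g)
    (ht : 0 ≤ t) (hs : 0 ≤ s) :
    IsCritical (fiberMap a b c f g) (t, s) ↔
      fiberPartial a c f t s = 0 ∧ fiberPartial b c g s t = 0 := by
  have hderiv := (hasFDerivAt_fiberMap a b c hf hg t s).hasFDerivWithinAt (s := quadrant)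
  rw [← smul_fst_add_smul_snd_eq_zero_iff]
  exact ⟨(((uniqueDiffOn_Ici 0).prod (uniqueDiffOn_Ici 0)) (t, s) ⟨ht, hs⟩).eq hderiv,
    fun h => by rwa [h] at hderiv⟩

theorem tendsto_primF_sub_mul_sq (hf : NehariNonlinearity f) (a : ℝ) :
    Tendsto (fun t => primF f t - a * t ^ 2) (cocompact ℝ) atTop := by
  have hsq : Tendsto (fun t : ℝ => |t| ^ 2) (cocompact ℝ) atTop :=
    (tendsto_pow_atTop two_ne_zero).comp tendsto_norm_cocompact_atTop
  refine ((tendsto_atTop_add_const_right _ (-a) hf.superquadratic).atTop_mul_atTop₀ hsq).congr' ?_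
  filter_upwards [hsq.eventually_gt_atTop 0] with t ht
  rw [add_mul, div_mul_cancel₀ _ ht.ne', sq_abs]
  ring

theorem tendsto_neg_fiberMap (hf : NehariNonlinearity f) (hg : NehariNonlinearity g) (hc : 0 ≤ c) :
    Tendsto (fun p => -fiberMap a b c f g p) (cocompact (ℝ × ℝ)) atTop := by
  have hF := tendsto_primF_sub_mul_sq hf ((a + c) / 2)
  have hG := tendsto_primF_sub_mul_sq hg ((b + c) / 2)
  obtain ⟨t₀, ht₀⟩ := (hf.continuous_primF.sub (by fun_prop)).exists_forall_le hF
  obtain ⟨s₀, hs₀⟩ := (hg.continuous_primF.sub (by fun_prop)).exists_forall_le hG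
  have hsum : Tendsto (fun p : ℝ × ℝ => (primF f p.1 - (a + c) / 2 * p.1 ^ 2) +
      (primF g p.2 - (b + c) / 2 * p.2 ^ 2)) (cocompact (ℝ × ℝ)) atTop := by
    rw [← coprod_cocompact]
    exact tendsto_sup.2 ⟨tendsto_atTop_add_right_of_le _ _ (hF.comp tendsto_comap) fun p => hs₀ p.2,
      tendsto_atTop_add_left_of_le _ _ (fun p => ht₀ p.1) (hG.comp tendsto_comap)⟩
  refine tendsto_atTop_mono (fun p => ?_) hsum
  simp only [fiberMap]
  nlinarith [mul_nonneg hc (sq_nonneg (p.1 - p.2))]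

theorem exists_isMaxOn_fiberMap (hf : NehariNonlinearity f) (hg : NehariNonlinearity g)
    (hc : 0 ≤ c) : ∃ p ∈ quadrant, IsMaxOn (fiberMap a b c f g) quadrant p := by
  have hcont : Continuous (fiberMap a b c f g) :=
    continuous_iff_continuousAt.2 fun p => (hasFDerivAt_fiberMap a b c hf hg p.1 p.2).continuousAt
  refine hcont.continuousOn.exists_isMaxOn' (isClosed_Ici.prod isClosed_Ici)
    (x₀ := 0) ⟨Set.self_mem_Ici, Set.self_mem_Ici⟩ ?_
  filter_upwards [mem_inf_of_left ((tendsto_neg_fiberMap hf hg hc).eventually_ge_atTop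
    (-fiberMap a b c f g 0))] with p hp using neg_le_neg_iff.1 hp

theorem exists_fiberMap_zero_lt (hf : NehariNonlinearity f) (ha : 0 < a) (hc : 0 ≤ c)
    (hs : 0 ≤ s) : ∃ t, 0 < t ∧ fiberMap a b c f g (0, s) < fiberMap a b c f g (t, s) := by
  have hsmall : ∀ᶠ t in 𝓝[>] 0, f t / |t| < a / 2 :=
    (hf.origin.mono_left (nhdsGT_le_nhdsNE (0 : ℝ))).eventually_lt_const (half_pos ha)
  obtain ⟨t, hft, ht : 0 < t⟩ := (hsmall.and self_mem_nhdsWithin).exists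
  refine ⟨t, ht, ?_⟩
  have hprim : primF f t < a / 2 * t ^ 2 := by
    rw [abs_of_pos ht, div_lt_iff₀ ht] at hft
    nlinarith [hf.primF_le_mul_self t]
  have hcross : 0 ≤ c * t * s := by positivity
  have hprim0 : primF f 0 = 0 := intervalIntegral.integral_same
  simp only [fiberMap, hprim0]
  nlinarith

theorem pos_of_isMaxOn_fiberMap (hf : NehariNonlinearity f) (hg : NehariNonlinearity g)
    (ha : 0 < a) (hb : 0 < b) (hc : 0 ≤ c) (hts : (t, s) ∈ quadrant)
    (hmax : IsMaxOn (fiberMap a b c f g) quadrant (t, s)) : 0 < t ∧ 0 < s := by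
  obtain ⟨ht : 0 ≤ t, hs : 0 ≤ s⟩ := hts
  refine ⟨ht.lt_of_ne ?_, hs.lt_of_ne ?_⟩
  · rintro rfl
    obtain ⟨t', ht', hlt⟩ := exists_fiberMap_zero_lt (b := b) (g := g) hf ha hc hs
    exact hlt.not_ge (hmax ⟨ht'.le, hs⟩)
  · rintro rfl
    obtain ⟨s', hs', hlt⟩ := exists_fiberMap_zero_lt (b := a) (g := f) hg hb hc ht
    rw [← fiberMap_swap, ← fiberMap_swap b a c g f (s', t)] at hlt
    exact hlt.not_ge (hmax ⟨ht, hs'.le⟩)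

theorem fiberPartial_eq_zero_of_isMaxOn (hf : NehariNonlinearity f) (hg : NehariNonlinearity g)
    (ht : 0 < t) (hs : 0 < s) (hmax : IsMaxOn (fiberMap a b c f g) quadrant (t, s)) :
    fiberPartial a c f t s = 0 ∧ fiberPartial b c g s t = 0 :=
  smul_fst_add_smul_snd_eq_zero_iff.1 <|
    (hmax.isLocalMax (prod_mem_nhds (Ici_mem_nhds ht) (Ici_mem_nhds hs))).hasFDerivAt_eq_zero
      (hasFDerivAt_fiberMap a b c hf hg t s)

theorem strictAntiOn_fiberPartial_div (hf : NehariNonlinearity f) (hc : 0 ≤ c) (hs : 0 ≤ s) :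
    StrictAntiOn (fun t => fiberPartial a c f t s / t) (Set.Ioi 0) := by
  intro t (ht : 0 < t) r (hr : 0 < r) htr
  have hslope := hf.strictMono_div_abs htr
  have hcross : c * s / r ≤ c * s / t := by gcongr
  simp only [fiberPartial, abs_of_pos ht, abs_of_pos hr, sub_div, add_div,
    mul_div_cancel_right₀ _ ht.ne', mul_div_cancel_right₀ _ hr.ne'] at hslope ⊢
  linarith

theorem fiberPartial_pos (hf : NehariNonlinearity f) (hc : 0 ≤ c) (hs : 0 ≤ s)
    (hzero : fiberPartial a c f t s = 0) (hr : 0 < r) (hrt : r < t) :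
    0 < fiberPartial a c f r s := by
  have h := strictAntiOn_fiberPartial_div (a := a) hf hc hs hr (hr.trans hrt) hrt
  simpa only [hzero, zero_div, div_pos_iff_of_pos_right hr] using h

theorem fiberPartial_neg (hf : NehariNonlinearity f) (hc : 0 ≤ c) (ht : 0 < t) (hs : 0 ≤ s)
    (hzero : fiberPartial a c f t s = 0) (htr : t < r) : fiberPartial a c f r s < 0 := by
  have hr := ht.trans htr
  have h := strictAntiOn_fiberPartial_div (a := a) hf hc hs ht hr htr
  simpa only [hzero, zero_div, div_lt_iff₀ hr, zero_mul] using h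

-- A zero of the partial derivative has `f t / t = a + c * (s / t)`, and `f t / t` increases with
-- `t`; hence of two zeros the one with the larger ratio `s / t` has the larger `t`.
theorem le_of_fiberPartial_eq_zero (hf : NehariNonlinearity f) (hc : 0 ≤ c) {t' s' : ℝ}
    (ht : 0 < t) (ht' : 0 < t') (hzero : fiberPartial a c f t s = 0)
    (hzero' : fiberPartial a c f t' s' = 0) (hratio : s' * t ≤ s * t') : t' ≤ t := by
  rw [fiberPartial, sub_eq_zero] at hzero hzero'
  refine hf.strictMono_div_abs.le_iff_le.1 ?_
  rw [← hzero, ← hzero', abs_of_pos ht, abs_of_pos ht', div_le_div_iff₀ ht' ht]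
  nlinarith

theorem eq_of_fiberPartial_eq_zero (hf : NehariNonlinearity f) (hg : NehariNonlinearity g)
    (hc : 0 ≤ c) {t' s' : ℝ} (ht : 0 < t) (hs : 0 < s) (ht' : 0 < t') (hs' : 0 < s')
    (hzero : fiberPartial a c f t s = 0 ∧ fiberPartial b c g s t = 0)
    (hzero' : fiberPartial a c f t' s' = 0 ∧ fiberPartial b c g s' t' = 0) :
    t' = t ∧ s' = s := by
  rcases le_total (s' * t) (s * t') with h | h
  · have htle := le_of_fiberPartial_eq_zero hf hc ht ht' hzero.1 hzero'.1 h
    have hsle := le_of_fiberPartial_eq_zero hg hc hs' hs hzero'.2 hzero.2 (by linarith)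
    constructor <;> nlinarith
  · have htle := le_of_fiberPartial_eq_zero hf hc ht' ht hzero'.1 hzero.1 h
    have hsle := le_of_fiberPartial_eq_zero hg hc hs hs' hzero.2 hzero'.2 (by linarith)
    constructor <;> nlinarith

theorem exists_strict_max_fiberMap (hf : NehariNonlinearity f) (hg : NehariNonlinearity g)
    (ha : 0 < a) (hb : 0 < b) (hc : 0 ≤ c) :
    ∃ t s : ℝ, 0 < t ∧ 0 < s ∧ fiberPartial a c f t s = 0 ∧ fiberPartial b c g s t = 0 ∧
      ∀ p ∈ quadrant, p ≠ (t, s) → fiberMap a b c f g p < fiberMap a b c f g (t, s) := by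
  obtain ⟨⟨t, s⟩, hmem, hmax⟩ := exists_isMaxOn_fiberMap (a := a) (b := b) hf hg hc
  obtain ⟨ht, hs⟩ := pos_of_isMaxOn_fiberMap hf hg ha hb hc hmem hmax
  have hzero := fiberPartial_eq_zero_of_isMaxOn hf hg ht hs hmax
  refine ⟨t, s, ht, hs, hzero.1, hzero.2, fun p hp hne => (hmax hp).lt_of_ne fun heq => hne ?_⟩
  obtain ⟨t', s'⟩ := p
  have hmax' : IsMaxOn (fiberMap a b c f g) quadrant (t', s') :=
    fun q hq => (hmax hq).trans_eq heq.symm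
  obtain ⟨ht', hs'⟩ := pos_of_isMaxOn_fiberMap hf hg ha hb hc hp hmax'
  have hzero' := fiberPartial_eq_zero_of_isMaxOn hf hg ht' hs' hmax'
  exact Prod.ext_iff.2 (eq_of_fiberPartial_eq_zero hf hg hc ht hs ht' hs' hzero hzero')

end FiberMap

section SpaceX

variable {N : ℕ} {α : ℝ} {V u v w : Rn N → ℝ}

theorem mem_spaceX_iff (hV : AEStronglyMeasurable V) (hV0 : ∀ x, 0 ≤ V x) :
    u ∈ spaceX α V ↔ MemD α u ∧ MemLp (fun x => √(V x) * u x) 2 := by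
  refine and_congr_right fun hu => ?_
  have hmeas : AEStronglyMeasurable fun x => √(V x) * u x :=
    (Real.continuous_sqrt.comp_aestronglyMeasurable hV).mul hu.aestronglyMeasurable
  simp only [memLp_two_iff_integrable_sq hmeas, mul_pow, Real.sq_sqrt (hV0 _), sq_abs]

theorem add_mem_spaceX (hV : AEStronglyMeasurable V) (hV0 : ∀ x, 0 ≤ V x) (hu : u ∈ spaceX α V)
    (hv : v ∈ spaceX α V) : u + v ∈ spaceX α V := by
  rw [mem_spaceX_iff hV hV0] at *
  refine ⟨hu.1.add hv.1, ?_⟩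
  exact (hu.2.add hv.2).ae_eq (.of_forall fun x => (mul_add _ _ _).symm)

theorem smul_mem_spaceX (hu : u ∈ spaceX α V) (c : ℝ) : c • u ∈ spaceX α V := by
  refine ⟨hu.1.const_smul c, ?_⟩
  simpa only [Pi.smul_apply, smul_eq_mul, abs_mul, mul_pow, mul_left_comm (V _)] using
    hu.2.const_mul (|c| ^ 2)

theorem abs_mem_spaceX (hα0 : 0 < α) (hα1 : α < 1) (hN : 2 * α < N) (hu : u ∈ spaceX α V) :
    (fun x => |u x|) ∈ spaceX α V :=
  ⟨hu.1.abs hα0 hα1 hN, by simpa only [abs_abs] using hu.2⟩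

theorem pos_mem_spaceX (hα0 : 0 < α) (hα1 : α < 1) (hN : 2 * α < N) (hV : AEStronglyMeasurable V)
    (hV0 : ∀ x, 0 ≤ V x) (hu : u ∈ spaceX α V) : pos u ∈ spaceX α V := by
  have heq : pos u = (1 / 2 : ℝ) • (u + fun x => |u x|) := by
    ext x
    simp [pos, add_abs_eq_two_nsmul_posPart, posPart_def]
  rw [heq]
  exact smul_mem_spaceX (add_mem_spaceX hV hV0 hu (abs_mem_spaceX hα0 hα1 hN hu)) _

theorem pos_add_neg (u : Rn N → ℝ) : pos u + neg u = u := by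
  ext x
  simp [pos, neg, max_add_min]

theorem neg_mem_spaceX (hα0 : 0 < α) (hα1 : α < 1) (hN : 2 * α < N) (hV : AEStronglyMeasurable V)
    (hV0 : ∀ x, 0 ≤ V x) (hu : u ∈ spaceX α V) : neg u ∈ spaceX α V := by
  have heq : neg u = u + (-1 : ℝ) • pos u := by
    rw [neg_one_smul, ← sub_eq_add_neg, eq_sub_iff_add_eq', pos_add_neg]
  rw [heq]
  exact add_mem_spaceX hV hV0 hu (smul_mem_spaceX (pos_mem_spaceX hα0 hα1 hN hV hV0 hu) _)

theorem integrable_mul_mul_of_mem_spaceX (hV : AEStronglyMeasurable V) (hV0 : ∀ x, 0 ≤ V x)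
    (hu : u ∈ spaceX α V) (hv : v ∈ spaceX α V) : Integrable fun x => V x * u x * v x := by
  rw [mem_spaceX_iff hV hV0] at hu hv
  refine (hu.2.integrable_mul hv.2).congr (.of_forall fun x => ?_)
  change √(V x) * u x * (√(V x) * v x) = V x * u x * v x
  rw [mul_mul_mul_comm, Real.mul_self_sqrt (hV0 x), mul_assoc]

/-- The inner product of `X`. -/
noncomputable def formX (α : ℝ) (V u v : Rn N → ℝ) : ℝ :=
  gagliardoForm α u v + ∫ x, V x * u x * v x

theorem formX_comm : formX α V u v = formX α V v u := by
  simp only [formX, gagliardoForm_comm (u := u), mul_right_comm]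

theorem formX_add_left (hα0 : 0 < α) (hα1 : α < 1) (hN : 2 * α < N) (hV : AEStronglyMeasurable V)
    (hV0 : ∀ x, 0 ≤ V x) (hu : u ∈ spaceX α V) (hv : v ∈ spaceX α V) (hw : w ∈ spaceX α V) :
    formX α V (u + v) w = formX α V u w + formX α V v w := by
  simp only [formX, Pi.add_apply, mul_add, add_mul]
  rw [integral_add (integrable_mul_mul_of_mem_spaceX hV hV0 hu hw)
      (integrable_mul_mul_of_mem_spaceX hV hV0 hv hw),
    gagliardoForm_add_left (hu.1.memLp_diffQuotient hα0 hα1 hN)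
      (hv.1.memLp_diffQuotient hα0 hα1 hN) (hw.1.memLp_diffQuotient hα0 hα1 hN)]
  ring

theorem formX_smul_left (c : ℝ) : formX α V (c • u) v = c * formX α V u v := by
  simp only [formX, gagliardoForm_smul_left, Pi.smul_apply, smul_eq_mul, mul_left_comm (V _),
    mul_assoc c, integral_const_mul, mul_add]

theorem formX_smul_right (c : ℝ) : formX α V u (c • v) = c * formX α V u v := by
  rw [formX_comm, formX_smul_left, formX_comm]

theorem formX_add_self (hα0 : 0 < α) (hα1 : α < 1) (hN : 2 * α < N) (hV : AEStronglyMeasurable V)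
    (hV0 : ∀ x, 0 ≤ V x) (hu : u ∈ spaceX α V) (hv : v ∈ spaceX α V) :
    formX α V (u + v) (u + v) = formX α V u u + 2 * formX α V u v + formX α V v v := by
  have hadd {w : Rn N → ℝ} (hw : w ∈ spaceX α V) := formX_add_left hα0 hα1 hN hV hV0 hu hv hw
  rw [hadd (add_mem_spaceX hV hV0 hu hv), formX_comm, hadd hu, formX_comm (v := u + v), hadd hv,
    formX_comm (u := v)]
  ring

theorem normX_sq (hα0 : 0 < α) (hα1 : α < 1) (hN : 2 * α < N) (hV0 : ∀ x, 0 ≤ V x)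
    (hu : u ∈ spaceX α V) : normX α V u ^ 2 = formX α V u u := by
  have h_int : 0 ≤ ∫ x, V x * |u x| ^ 2 :=
    integral_nonneg fun x => mul_nonneg (hV0 x) (sq_nonneg _)
  rw [normX, Real.sq_sqrt (by positivity),
    toReal_gagliardo_sq (hu.1.memLp_diffQuotient hα0 hα1 hN), formX]
  simp only [sq_abs]
  simp only [sq, mul_assoc]

theorem formX_self_pos (hα0 : 0 < α) (hα1 : α < 1) (hN : 2 * α < N) (hV0 : ∀ x, 0 ≤ V x)
    (hu : u ∈ spaceX α V) (h0 : Nonzero u) : 0 < formX α V u u := by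
  have hQ := hu.1.memLp_diffQuotient hα0 hα1 hN
  refine add_pos_of_pos_of_nonneg ?_ (integral_nonneg fun x => ?_)
  · rw [← toReal_gagliardo_sq hQ]
    refine pow_pos (ENNReal.toReal_pos (hu.1.gagliardo_pos hα0 hN h0).ne' ?_) 2
    rw [gagliardo_eq_eLpNorm]
    exact hQ.2.ne
  · rw [mul_assoc]
    exact mul_nonneg (hV0 x) (mul_self_nonneg (u x))

theorem pos_eq_zero_or_neg_eq_zero (u : Rn N → ℝ) (x : Rn N) : pos u x = 0 ∨ neg u x = 0 :=
  (le_total (u x) 0).imp max_eq_right min_eq_right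

-- `u⁺` and `u⁻` are both monotone functions of `u`, so their increments have the same sign.
theorem formX_pos_neg_nonneg (u : Rn N → ℝ) : 0 ≤ formX α V (pos u) (neg u) := by
  have hmono (x y : Rn N) : 0 ≤ (pos u x - pos u y) * (neg u x - neg u y) := by
    rcases le_total (u x) (u y) with h | h
    · exact mul_nonneg_of_nonpos_of_nonpos (sub_nonpos.2 (max_le_max_right 0 h))
        (sub_nonpos.2 (min_le_min_right 0 h))
    · exact mul_nonneg (sub_nonneg.2 (max_le_max_right 0 h)) (sub_nonneg.2 (min_le_min_right 0 h))
  have hdisj (x : Rn N) : V x * pos u x * neg u x = 0 := by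
    rcases pos_eq_zero_or_neg_eq_zero u x with h | h <;> simp [h]
  simp only [formX, hdisj, integral_zero, add_zero]
  exact integral_nonneg fun p => div_nonneg (hmono p.1 p.2) (by positivity)

end SpaceX

section Energy

variable {N : ℕ} {α : ℝ} {V K u v w φ ψ : Rn N → ℝ} {f : ℝ → ℝ}

/-- The growth of the nonlinearity under which `∫ K F(u)` is controlled by the norms of `u` in
`L²(V dx)` and in the critical Lebesgue space. -/
def CriticalGrowth (α : ℝ) (V K : Rn N → ℝ) (f : ℝ → ℝ) : Prop :=
  ∃ C, ∀ᵐ x, ∀ t, |K x * f t * t| ≤ C * (V x * |t| ^ 2 + |t| ^ critExp α N)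

/-- The derivative `t ↦ ∫ K f(t v) v` of `t ↦ ∫ K F(t v)`. -/
noncomputable def rayNonlinearity (K : Rn N → ℝ) (f : ℝ → ℝ) (v : Rn N → ℝ) (t : ℝ) : ℝ :=
  ∫ x, K x * f (t * v x) * v x

theorem CriticalGrowth.integrable (hα0 : 0 < α) (hα1 : α < 1) (hN : 2 * α < N)
    (hK : AEStronglyMeasurable K) (hf : Continuous f) (hgrowth : CriticalGrowth α V K f)
    (hu : u ∈ spaceX α V) : Integrable fun x => K x * f (u x) * u x := by
  obtain ⟨C, hC⟩ := hgrowth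
  have hP := critExp_pos hα0 hN
  have hcrit : Integrable fun x => |u x| ^ critExp α N := by
    simpa only [ENNReal.toReal_ofReal hP.le, Real.norm_eq_abs] using
      (hu.1.memLp_critExp hα0 hα1 hN).integrable_norm_rpow (ENNReal.ofReal_pos.2 hP).ne'
        ENNReal.ofReal_ne_top
  have hu_meas := hu.1.aestronglyMeasurable
  exact ((hu.2.add hcrit).const_mul C).mono'
    ((hK.mul (hf.comp_aestronglyMeasurable hu_meas)).mul hu_meas) (hC.mono fun x hx => hx (u x))

theorem CriticalGrowth.integrable_ray (hα0 : 0 < α) (hα1 : α < 1) (hN : 2 * α < N)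
    (hK : AEStronglyMeasurable K) (hf : NehariNonlinearity f) (hgrowth : CriticalGrowth α V K f)
    (hv : v ∈ spaceX α V) (t : ℝ) : Integrable fun x => K x * f (t * v x) * v x := by
  rcases eq_or_ne t 0 with rfl | ht
  · simp [hf.map_zero]
  · refine ((hgrowth.integrable hα0 hα1 hN hK hf.continuous
      (smul_mem_spaceX hv t)).const_mul t⁻¹).congr (.of_forall fun x => ?_)
    simp only [Pi.smul_apply, smul_eq_mul]
    field

theorem CriticalGrowth.integrable_primF (hα0 : 0 < α) (hα1 : α < 1) (hN : 2 * α < N)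
    (hK : AEStronglyMeasurable K) (hK0 : ∀ x, 0 < K x) (hf : NehariNonlinearity f)
    (hgrowth : CriticalGrowth α V K f) (hu : u ∈ spaceX α V) :
    Integrable fun x => K x * primF f (u x) := by
  refine (hgrowth.integrable hα0 hα1 hN hK hf.continuous hu).mono' (hK.mul
    (hf.continuous_primF.comp_aestronglyMeasurable hu.1.aestronglyMeasurable))
    (.of_forall fun x => ?_)
  rw [Real.norm_of_nonneg (mul_nonneg (hK0 x).le (hf.primF_nonneg _)), mul_assoc]
  exact mul_le_mul_of_nonneg_left (hf.primF_le_mul_self _) (hK0 x).le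

theorem nehariNonlinearity_rayNonlinearity (hα0 : 0 < α) (hα1 : α < 1) (hN : 2 * α < N)
    (hK : AEStronglyMeasurable K) (hK0 : ∀ x, 0 < K x) (hf : NehariNonlinearity f)
    (hgrowth : CriticalGrowth α V K f) (hv : v ∈ spaceX α V) (h0 : Nonzero v) :
    NehariNonlinearity (rayNonlinearity K f v) ∧
      ∀ t, primF (rayNonlinearity K f v) t = ∫ x, K x * primF f (t * v x) :=
  hf.integral_const_mul_comp_mul hK hK0 hv.1.aestronglyMeasurable h0
    (hgrowth.integrable_ray hα0 hα1 hN hK hf hv)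

theorem dEnergy_eq : dEnergy α V K f u φ = formX α V u φ - ∫ x, K x * f (u x) * φ x := rfl

theorem dEnergy_smul_right (c : ℝ) : dEnergy α V K f u (c • φ) = c * dEnergy α V K f u φ := by
  simp only [dEnergy_eq, formX_smul_right, Pi.smul_apply, smul_eq_mul,
    mul_left_comm _ c, integral_const_mul, mul_sub]

theorem dEnergy_add_right (hα0 : 0 < α) (hα1 : α < 1) (hN : 2 * α < N)
    (hV : AEStronglyMeasurable V) (hV0 : ∀ x, 0 ≤ V x) (hu : u ∈ spaceX α V)
    (hφ : φ ∈ spaceX α V) (hψ : ψ ∈ spaceX α V)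
    (hφ_int : Integrable fun x => K x * f (u x) * φ x)
    (hψ_int : Integrable fun x => K x * f (u x) * ψ x) :
    dEnergy α V K f u (φ + ψ) = dEnergy α V K f u φ + dEnergy α V K f u ψ := by
  simp only [dEnergy_eq, formX_comm (u := u), formX_add_left hα0 hα1 hN hV hV0 hφ hψ hu,
    Pi.add_apply, mul_add, integral_add hφ_int hψ_int]
  ring

theorem dEnergy_smul_add_smul (hα0 : 0 < α) (hα1 : α < 1) (hN : 2 * α < N)
    (hV : AEStronglyMeasurable V) (hV0 : ∀ x, 0 ≤ V x) (hv : v ∈ spaceX α V)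
    (hw : w ∈ spaceX α V) (hvw : ∀ x, v x = 0 ∨ w x = 0) (t s : ℝ) :
    dEnergy α V K f (t • v + s • w) v =
      fiberPartial (formX α V v v) (formX α V v w) (rayNonlinearity K f v) t s := by
  have hpot : ∫ x, K x * f ((t • v + s • w) x) * v x = rayNonlinearity K f v t :=
    integral_congr_ae (.of_forall fun x => by rcases hvw x with h | h <;> simp [h])
  rw [dEnergy_eq, hpot, formX_add_left hα0 hα1 hN hV hV0 (smul_mem_spaceX hv t)
    (smul_mem_spaceX hw s) hv, formX_smul_left, formX_smul_left, formX_comm (u := w), fiberPartial]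
  ring

theorem energy_smul_add_smul (hα0 : 0 < α) (hα1 : α < 1) (hN : 2 * α < N)
    (hV : AEStronglyMeasurable V) (hV0 : ∀ x, 0 ≤ V x) (hK : AEStronglyMeasurable K)
    (hK0 : ∀ x, 0 < K x) (hf : NehariNonlinearity f) (hgrowth : CriticalGrowth α V K f)
    (hv : v ∈ spaceX α V) (hw : w ∈ spaceX α V) (hv0 : Nonzero v) (hw0 : Nonzero w)
    (hvw : ∀ x, v x = 0 ∨ w x = 0) (p : ℝ × ℝ) :
    energy α V K f (p.1 • v + p.2 • w) =
      fiberMap (formX α V v v) (formX α V w w) (formX α V v w) (rayNonlinearity K f v)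
        (rayNonlinearity K f w) p := by
  obtain ⟨t, s⟩ := p
  have htv := smul_mem_spaceX hv t
  have hsw := smul_mem_spaceX hw s
  have hform : formX α V (t • v + s • w) (t • v + s • w) =
      formX α V v v * t ^ 2 + 2 * formX α V v w * t * s + formX α V w w * s ^ 2 := by
    rw [formX_add_self hα0 hα1 hN hV hV0 htv hsw]
    simp only [formX_smul_left, formX_smul_right]
    ring
  have htv_int : Integrable fun x => K x * primF f (t * v x) :=
    hgrowth.integrable_primF hα0 hα1 hN hK hK0 hf htv
  have hsw_int : Integrable fun x => K x * primF f (s * w x) :=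
    hgrowth.integrable_primF hα0 hα1 hN hK hK0 hf hsw
  have hpot : ∫ x, K x * primF f ((t • v + s • w) x) =
      primF (rayNonlinearity K f v) t + primF (rayNonlinearity K f w) s := by
    rw [(nehariNonlinearity_rayNonlinearity hα0 hα1 hN hK hK0 hf hgrowth hv hv0).2,
      (nehariNonlinearity_rayNonlinearity hα0 hα1 hN hK hK0 hf hgrowth hw hw0).2,
      ← integral_add htv_int hsw_int]
    refine integral_congr_ae (.of_forall fun x => ?_)
    rcases hvw x with h | h <;> simp [h, primF]
  rw [energy, normX_sq hα0 hα1 hN hV0 (add_mem_spaceX hV hV0 htv hsw), hform, hpot, fiberMap]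
  ring

theorem pos_comb {t s : ℝ} (ht : 0 ≤ t) (hs : 0 ≤ s) :
    pos (comb u t s) = t • pos u := by
  ext x
  rcases le_total (u x) 0 with h | h
  · simpa [pos, neg, comb, h] using mul_nonpos_of_nonneg_of_nonpos hs h
  · simpa [pos, neg, comb, h] using mul_nonneg ht h

theorem neg_comb {t s : ℝ} (ht : 0 ≤ t) (hs : 0 ≤ s) : neg (comb u t s) = s • neg u := by
  ext x
  rcases le_total (u x) 0 with h | h
  · simpa [pos, neg, comb, h] using mul_nonpos_of_nonneg_of_nonpos hs h
  · simpa [pos, neg, comb, h] using mul_nonneg ht h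

theorem comb_mem_spaceX (hα0 : 0 < α) (hα1 : α < 1) (hN : 2 * α < N)
    (hV : AEStronglyMeasurable V) (hV0 : ∀ x, 0 ≤ V x) (hu : u ∈ spaceX α V) (t s : ℝ) :
    comb u t s ∈ spaceX α V :=
  add_mem_spaceX hV hV0 (smul_mem_spaceX (pos_mem_spaceX hα0 hα1 hN hV hV0 hu) t)
    (smul_mem_spaceX (neg_mem_spaceX hα0 hα1 hN hV hV0 hu) s)

theorem nonzero_smul_iff {c : ℝ} : Nonzero (c • v) ↔ c ≠ 0 ∧ Nonzero v := by
  rcases eq_or_ne c 0 with rfl | hc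
  · simp [Nonzero, EventuallyEq]
  · simp [Nonzero, EventuallyEq, hc]

theorem nonzero_of_nonzero_pos (hu : Nonzero (pos u)) : Nonzero u :=
  fun h => hu (h.mono fun x hx => by simp [pos, hx])

theorem dEnergy_self (hα0 : 0 < α) (hα1 : α < 1) (hN : 2 * α < N)
    (hV : AEStronglyMeasurable V) (hV0 : ∀ x, 0 ≤ V x) (hK : AEStronglyMeasurable K)
    (hf : Continuous f) (hgrowth : CriticalGrowth α V K f) (hu : u ∈ spaceX α V) :
    dEnergy α V K f u u = dEnergy α V K f u (pos u) + dEnergy α V K f u (neg u) := by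
  have hp := pos_mem_spaceX hα0 hα1 hN hV hV0 hu
  have hn := neg_mem_spaceX hα0 hα1 hN hV hV0 hu
  have hp_int : Integrable fun x => K x * f (u x) * pos u x := by
    refine (hgrowth.integrable hα0 hα1 hN hK hf hp).congr (.of_forall fun x => ?_)
    rcases le_total (u x) 0 with h | h <;> simp [pos, h]
  have hn_int : Integrable fun x => K x * f (u x) * neg u x := by
    refine (hgrowth.integrable hα0 hα1 hN hK hf hn).congr (.of_forall fun x => ?_)
    rcases le_total (u x) 0 with h | h <;> simp [neg, h]
  rw [← dEnergy_add_right hα0 hα1 hN hV hV0 hu hp hn hp_int hn_int, pos_add_neg]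

theorem mem_nodal_iff (hα0 : 0 < α) (hα1 : α < 1) (hN : 2 * α < N)
    (hV : AEStronglyMeasurable V) (hV0 : ∀ x, 0 ≤ V x) (hK : AEStronglyMeasurable K)
    (hf : Continuous f) (hgrowth : CriticalGrowth α V K f) (hu : u ∈ spaceX α V) :
    u ∈ nodal α V K f ↔ Nonzero (pos u) ∧ Nonzero (neg u) ∧
      dEnergy α V K f u (pos u) = 0 ∧ dEnergy α V K f u (neg u) = 0 := by
  refine ⟨And.right, fun h => ⟨⟨hu, nonzero_of_nonzero_pos h.1, ?_⟩, h⟩⟩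
  rw [dEnergy_self hα0 hα1 hN hV hV0 hK hf hgrowth hu, h.2.2.1, h.2.2.2, add_zero]

theorem comb_mem_nodal_iff (hα0 : 0 < α) (hα1 : α < 1) (hN : 2 * α < N)
    (hV : AEStronglyMeasurable V) (hV0 : ∀ x, 0 ≤ V x) (hK : AEStronglyMeasurable K)
    (hf : Continuous f) (hgrowth : CriticalGrowth α V K f) (hu : u ∈ spaceX α V)
    (hpos : Nonzero (pos u)) (hneg : Nonzero (neg u)) {t s : ℝ} (ht : 0 ≤ t) (hs : 0 ≤ s) :
    comb u t s ∈ nodal α V K f ↔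
      (Phi1 α V K f u t s = 0 ∧ Phi2 α V K f u t s = 0) ∧ 0 < t ∧ 0 < s := by
  rw [mem_nodal_iff hα0 hα1 hN hV hV0 hK hf hgrowth (comb_mem_spaceX hα0 hα1 hN hV hV0 hu t s),
    pos_comb ht hs, neg_comb ht hs, nonzero_smul_iff, nonzero_smul_iff, dEnergy_smul_right,
    dEnergy_smul_right, ht.lt_iff_ne', hs.lt_iff_ne', Phi1, Phi2]
  simp only [mul_eq_zero, hpos, hneg]
  tauto

end Energy

section Growth

theorem exists_abs_le_mul_of_isBigO {f g : ℝ → ℝ} (hf : Continuous f) (hg : Continuous g)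
    (hg0 : ∀ t ≠ 0, 0 < g t) (h0 : f =O[𝓝[≠] 0] g) (hinf : f =O[cocompact ℝ] g) :
    ∃ C, 0 ≤ C ∧ ∀ t ≠ 0, |f t| ≤ C * g t := by
  obtain ⟨c, hc⟩ := h0.bound
  obtain ⟨d, hd⟩ := hinf.bound
  obtain ⟨U, hU, hU0, hUc⟩ := mem_nhdsWithin.1 hc
  obtain ⟨L, hL, hLd⟩ := mem_cocompact.1 hd
  have hquot : ContinuousOn (fun t => f t / g t) (L \ U) :=
    hf.continuousOn.div hg.continuousOn fun t ht => (hg0 t fun h => ht.2 (h ▸ hU0)).ne'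
  obtain ⟨B, hB⟩ := (hL.diff hU).exists_bound_of_continuousOn hquot
  refine ⟨max 0 (max c (max d B)), le_max_left _ _, fun t ht => ?_⟩
  have hgt := hg0 t ht
  rw [← div_le_iff₀ hgt]
  by_cases htU : t ∈ U
  · have : ‖f t‖ ≤ c * ‖g t‖ := hUc ⟨htU, ht⟩
    rw [Real.norm_of_nonneg hgt.le, ← div_le_iff₀ hgt] at this
    exact this.trans (by simp)
  by_cases htL : t ∈ L
  · have : ‖f t / g t‖ ≤ B := hB t ⟨htL, htU⟩
    rw [norm_div, Real.norm_of_nonneg hgt.le] at this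
    exact this.trans (by simp)
  · have : ‖f t‖ ≤ d * ‖g t‖ := hLd htL
    rw [Real.norm_of_nonneg hgt.le, ← div_le_iff₀ hgt] at this
    exact this.trans (by simp)

theorem exists_abs_le_mul_rpow_add_rpow {f : ℝ → ℝ} {m P : ℝ} (hf : Continuous f) (hm : 0 ≤ m)
    (hP : 0 ≤ P) (h0 : f =O[𝓝[≠] 0] fun t => |t| ^ m) (hinf : f =O[cocompact ℝ] fun t => |t| ^ P) :
    ∃ C, 0 ≤ C ∧ ∀ t ≠ 0, |f t| ≤ C * (|t| ^ m + |t| ^ P) := by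
  have hnorm (p t : ℝ) : ‖|t| ^ p‖ = |t| ^ p := Real.norm_of_nonneg (by positivity)
  exact exists_abs_le_mul_of_isBigO hf
    ((continuous_abs.rpow_const fun _ => .inr hm).add (continuous_abs.rpow_const fun _ => .inr hP))
    (fun t ht => by positivity)
    (h0.trans (.of_norm_le fun t =>
      (hnorm m t).trans_le (le_add_of_nonneg_right (by positivity))))
    (hinf.trans (.of_norm_le fun t =>
      (hnorm P t).trans_le (le_add_of_nonneg_left (by positivity))))

theorem rpow_mul_rpow_le_mul_sq_add_rpow {m P a b : ℝ} (hm : 2 ≤ m) (hmP : m < P) (ha : 0 ≤ a)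
    (hb : 0 ≤ b) : a ^ ((P - m) / (P - 2)) * b ^ m ≤ a * b ^ 2 + b ^ P := by
  set θ := (P - m) / (P - 2) with hθ
  have hP2 : 0 < P - 2 := by linarith
  have hθ0 : 0 ≤ θ := div_nonneg (by linarith) hP2.le
  have hθ1 : θ ≤ 1 := (div_le_one hP2).2 (by linarith)
  have hexp : 2 * θ + P * (1 - θ) = m := by
    rw [hθ]
    field
  have hsq : 0 ≤ a * b ^ 2 := by positivity
  have hbP : 0 ≤ b ^ P := by positivity
  calc a ^ θ * b ^ m = (a * b ^ 2) ^ θ * (b ^ P) ^ (1 - θ) := by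
        rw [Real.mul_rpow ha (sq_nonneg b), ← Real.rpow_two, ← Real.rpow_mul hb,
          ← Real.rpow_mul hb, mul_assoc, ← Real.rpow_add_of_nonneg hb (by positivity)
            (mul_nonneg (by linarith) (by linarith)), hexp]
    _ ≤ θ * (a * b ^ 2) + (1 - θ) * b ^ P :=
        Real.geom_mean_le_arith_mean2_weighted hθ0 (by linarith) hsq hbP (by ring)
    _ ≤ a * b ^ 2 + b ^ P :=
        add_le_add (mul_le_of_le_one_left hsq hθ1) (mul_le_of_le_one_left hbP (by linarith))

theorem exists_ae_le_of_memLp_top {X : Type*} [MeasurableSpace X] {μ : Measure X} {g : X → ℝ}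
    (hg : MemLp g ⊤ μ) : ∃ C, 0 ≤ C ∧ ∀ᵐ x ∂μ, g x ≤ C := by
  have htop := hg.2
  rw [eLpNorm_exponent_top] at htop
  refine ⟨(eLpNormEssSup g μ).toReal, ENNReal.toReal_nonneg, ?_⟩
  filter_upwards [ae_le_eLpNormEssSup (f := g) (μ := μ)] with x hx
  rw [← ofReal_norm, ENNReal.ofReal_le_iff_le_toReal htop.ne] at hx
  exact (le_abs_self _).trans hx

variable {N : ℕ} {α m : ℝ} {V K : Rn N → ℝ} {f : ℝ → ℝ}

theorem CondH3.exists_ae_le (hV0 : ∀ x, 0 < V x) (h : CondH3 V K) :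
    ∃ D, 0 ≤ D ∧ ∀ᵐ x, K x ≤ D * V x := by
  obtain ⟨D, hD0, hD⟩ := exists_ae_le_of_memLp_top h
  exact ⟨D, hD0, hD.mono fun x hx => (div_le_iff₀ (hV0 x)).1 hx⟩

theorem CondH4.exists_le (hV : Continuous V) (hK : Continuous K) (hV0 : ∀ x, 0 < V x)
    (h : CondH4 α m V K) :
    ∃ D, 0 ≤ D ∧ ∀ x, K x ≤ D * V x ^ ((critExp α N - m) / (critExp α N - 2)) := by
  set θ := (critExp α N - m) / (critExp α N - 2)
  have hV_pow (x : Rn N) : 0 < V x ^ θ := Real.rpow_pos_of_pos (hV0 x) θ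
  have hcont : Continuous fun x => K x / V x ^ θ :=
    hK.div (hV.rpow_const fun x => .inl (hV0 x).ne') fun x => (hV_pow x).ne'
  obtain ⟨S, hS, hS1⟩ :=
    (hasBasis_cocompact.eventually_iff).1 (h.2.2.eventually_le_const (zero_lt_one' ℝ))
  obtain ⟨B, hB⟩ := hS.exists_bound_of_continuousOn hcont.continuousOn
  refine ⟨max B 1, by positivity, fun x => ?_⟩
  rw [← div_le_iff₀ (hV_pow x)]
  by_cases hx : x ∈ S
  · exact (le_abs_self _).trans ((hB x hx).trans (le_max_left _ _))
  · exact (hS1 hx).trans (le_max_right _ _)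

theorem CondF.isLittleO_abs (hf : CondF α V K f) : f =o[𝓝[≠] 0] fun t => |t| := by
  rcases hf.origin with ⟨-, hlim⟩ | ⟨m, hm, hO⟩
  · refine isLittleO_of_tendsto' ?_ hlim
    filter_upwards [self_mem_nhdsWithin] with t ht h
    exact absurd (abs_eq_zero.1 h) ht
  · have hm2 : 0 < m - 2 := by linarith [hm.1]
    have hpow : Tendsto (fun t : ℝ => |t| ^ (m - 2)) (𝓝[≠] 0) (𝓝 0) := by
      have hcont : Continuous fun t : ℝ => |t| ^ (m - 2) :=
        continuous_abs.rpow_const fun _ => .inr hm2.le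
      have := hcont.tendsto 0
      rw [abs_zero, Real.zero_rpow hm2.ne'] at this
      exact this.mono_left inf_le_left
    have hsplit : (fun t : ℝ => |t| ^ (m - 1)) =ᶠ[𝓝[≠] 0] fun t => |t| ^ (m - 2) * |t| := by
      filter_upwards [self_mem_nhdsWithin] with t ht
      rw [← Real.rpow_add_one (abs_ne_zero.2 ht)]
      ring_nf
    have hlittle : (fun t : ℝ => |t| ^ (m - 2) * |t|) =o[𝓝[≠] 0] fun t => 1 * |t| :=
      ((isLittleO_one_iff ℝ).2 hpow).mul_isBigO (isBigO_refl _ _)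
    simp only [one_mul] at hlittle
    exact (hO.trans_eventuallyEq hsplit).trans_isLittleO hlittle

theorem CondF.nehariNonlinearity (hf : CondF α V K f) : NehariNonlinearity f where
  continuous := hf.continuous
  origin := hf.isLittleO_abs.tendsto_div_nhds_zero
  superquadratic := hf.superquadratic
  increasing := hf.increasing

theorem isBigO_mul_self_rpow {l : Filter ℝ} {p : ℝ} (h0 : ∀ᶠ t in l, t ≠ 0)
    (h : f =O[l] fun t => |t| ^ (p - 1)) : (fun t => f t * t) =O[l] fun t => |t| ^ p := by
  refine (h.mul (isBigO_refl (fun t : ℝ => t) l).abs_right).trans_eventuallyEq ?_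
  filter_upwards [h0] with t ht
  rw [Real.rpow_sub_one (abs_ne_zero.2 ht), div_mul_cancel₀ _ (abs_ne_zero.2 ht)]

theorem CondF.exists_origin_growth (hα0 : 0 < α) (hN : 2 * α < N) (hVK : ClassK α V K)
    (hf : CondF α V K f) :
    ∃ m, 2 ≤ m ∧ m < critExp α N ∧ (fun t => f t * t) =O[𝓝[≠] 0] (fun t => |t| ^ m) ∧
      ∃ D, 0 ≤ D ∧ ∀ᵐ x, K x ≤ D * V x ^ ((critExp α N - m) / (critExp α N - 2)) := by
  have hne : ∀ᶠ t : ℝ in 𝓝[≠] 0, t ≠ 0 := self_mem_nhdsWithin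
  rcases hf.origin with ⟨h3, -⟩ | ⟨m, h4, hO⟩
  · have hP := two_lt_critExp hα0 hN
    obtain ⟨D, hD0, hD⟩ := h3.exists_ae_le hVK.V_pos
    refine ⟨2, le_rfl, hP, isBigO_mul_self_rpow hne ?_, D, hD0, ?_⟩
    · norm_num
      exact hf.isLittleO_abs.isBigO
    · simpa only [div_self (sub_pos.2 hP).ne', Real.rpow_one] using hD
  · obtain ⟨D, hD0, hD⟩ := h4.exists_le hVK.continuous_V hVK.continuous_K hVK.V_pos
    exact ⟨m, h4.1.le, h4.2.1, isBigO_mul_self_rpow hne hO, D, hD0, .of_forall hD⟩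

theorem CondF.isBigO_cocompact (hf : CondF α V K f) :
    (fun t => f t * t) =O[cocompact ℝ] fun t => |t| ^ critExp α N := by
  have hne : ∀ᶠ t : ℝ in cocompact ℝ, t ≠ 0 := isCompact_singleton.compl_mem_cocompact
  refine isBigO_mul_self_rpow hne (isLittleO_of_tendsto' ?_ hf.quasicritical).isBigO
  filter_upwards [hne] with t ht h
  exact absurd h (Real.rpow_pos_of_pos (abs_pos.2 ht) _).ne'

theorem ClassK.criticalGrowth (hα0 : 0 < α) (hN : 2 * α < N) (hVK : ClassK α V K)
    (hf : CondF α V K f) : CriticalGrowth α V K f := by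
  obtain ⟨m, hm, hmP, horigin, D, hD0, hD⟩ := hf.exists_origin_growth hα0 hN hVK
  obtain ⟨B, hB0, hB⟩ := exists_ae_le_of_memLp_top hVK.K_bounded
  obtain ⟨C, hC0, hC⟩ := exists_abs_le_mul_rpow_add_rpow (hf.continuous.mul continuous_id)
    (by linarith) (by linarith) horigin hf.isBigO_cocompact
  refine ⟨C * (D + B), ?_⟩
  filter_upwards [hD, hB] with x hDx hBx t
  rcases eq_or_ne t 0 with rfl | ht
  · have := hVK.V_pos x
    simp only [mul_zero, abs_zero]
    positivity
  set Q := V x * |t| ^ 2 + |t| ^ critExp α N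
  have hQm : K x * |t| ^ m ≤ D * Q :=
    calc K x * |t| ^ m
        ≤ D * V x ^ ((critExp α N - m) / (critExp α N - 2)) * |t| ^ m := by gcongr
      _ = D * (V x ^ ((critExp α N - m) / (critExp α N - 2)) * |t| ^ m) := mul_assoc _ _ _
      _ ≤ D * Q := mul_le_mul_of_nonneg_left
          (rpow_mul_rpow_le_mul_sq_add_rpow hm hmP (hVK.V_pos x).le (abs_nonneg t)) hD0
  have hQP : K x * |t| ^ critExp α N ≤ B * Q :=
    mul_le_mul hBx (le_add_of_nonneg_left (mul_nonneg (hVK.V_pos x).le (sq_nonneg _)))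
      (by positivity) hB0
  calc |K x * f t * t| = K x * |f t * t| := by
        rw [mul_assoc, abs_mul, abs_of_pos (hVK.K_pos x)]
    _ ≤ K x * (C * (|t| ^ m + |t| ^ critExp α N)) :=
        mul_le_mul_of_nonneg_left (hC t ht) (hVK.K_pos x).le
    _ = C * (K x * |t| ^ m + K x * |t| ^ critExp α N) := by ring
    _ ≤ C * (D * Q + B * Q) := by gcongr
    _ = C * (D + B) * Q := by ring

end Growth

section NodalFiber

variable {N : ℕ} {α : ℝ} {V K u : Rn N → ℝ} {f : ℝ → ℝ}

theorem Phi1_eq_fiberPartial (hα0 : 0 < α) (hα1 : α < 1) (hN : 2 * α < N)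
    (hV : AEStronglyMeasurable V) (hV0 : ∀ x, 0 ≤ V x) (hu : u ∈ spaceX α V) (t s : ℝ) :
    Phi1 α V K f u t s = fiberPartial (formX α V (pos u) (pos u)) (formX α V (pos u) (neg u))
      (rayNonlinearity K f (pos u)) t s :=
  dEnergy_smul_add_smul hα0 hα1 hN hV hV0 (pos_mem_spaceX hα0 hα1 hN hV hV0 hu)
    (neg_mem_spaceX hα0 hα1 hN hV hV0 hu) (pos_eq_zero_or_neg_eq_zero u) t s

theorem Phi2_eq_fiberPartial (hα0 : 0 < α) (hα1 : α < 1) (hN : 2 * α < N)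
    (hV : AEStronglyMeasurable V) (hV0 : ∀ x, 0 ≤ V x) (hu : u ∈ spaceX α V) (t s : ℝ) :
    Phi2 α V K f u t s = fiberPartial (formX α V (neg u) (neg u)) (formX α V (pos u) (neg u))
      (rayNonlinearity K f (neg u)) s t := by
  have hcomb : comb u t s = s • neg u + t • pos u := add_comm (t • pos u) (s • neg u)
  rw [Phi2, hcomb, formX_comm (u := pos u)]
  exact dEnergy_smul_add_smul hα0 hα1 hN hV hV0 (neg_mem_spaceX hα0 hα1 hN hV hV0 hu)
    (pos_mem_spaceX hα0 hα1 hN hV hV0 hu) (fun x => (pos_eq_zero_or_neg_eq_zero u x).symm) s t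

theorem hFun_eq_fiberMap (hα0 : 0 < α) (hα1 : α < 1) (hN : 2 * α < N)
    (hV : AEStronglyMeasurable V) (hV0 : ∀ x, 0 ≤ V x) (hK : AEStronglyMeasurable K)
    (hK0 : ∀ x, 0 < K x) (hf : NehariNonlinearity f) (hgrowth : CriticalGrowth α V K f)
    (hu : u ∈ spaceX α V) (hpos : Nonzero (pos u)) (hneg : Nonzero (neg u)) :
    hFun α V K f u = fiberMap (formX α V (pos u) (pos u)) (formX α V (neg u) (neg u))
      (formX α V (pos u) (neg u)) (rayNonlinearity K f (pos u)) (rayNonlinearity K f (neg u)) :=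
  funext <| energy_smul_add_smul hα0 hα1 hN hV hV0 hK hK0 hf hgrowth
    (pos_mem_spaceX hα0 hα1 hN hV hV0 hu) (neg_mem_spaceX hα0 hα1 hN hV hV0 hu) hpos hneg
    (pos_eq_zero_or_neg_eq_zero u)

end NodalFiber

end FracSchrodinger

theorem lemma4p1_general (N : ℕ) (α : ℝ) (hα0 : 0 < α) (hα1 : α < 1) (hN : 2 * α < (N : ℝ))
    (V K : Rn N → ℝ) (hV : AEStronglyMeasurable V) (hV0 : ∀ x, 0 ≤ V x)
    (hK : AEStronglyMeasurable K) (hK0 : ∀ x, 0 < K x) (f : ℝ → ℝ) (hf : NehariNonlinearity f)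
    (hgrowth : CriticalGrowth α V K f) (u : Rn N → ℝ) (hu : u ∈ spaceX α V)
    (hpos : Nonzero (pos u)) (hneg : Nonzero (neg u)) :
    (∀ t s : ℝ, 0 ≤ t → 0 ≤ s →
      HasFDerivWithinAt (hFun α V K f u)
        (Phi1 α V K f u t s • ContinuousLinearMap.fst ℝ ℝ ℝ +
          Phi2 α V K f u t s • ContinuousLinearMap.snd ℝ ℝ ℝ) quadrant (t, s)) ∧
    (∀ t s : ℝ, 0 ≤ t → 0 ≤ s →
      ((IsCritical (hFun α V K f u) (t, s) ∧ 0 < t ∧ 0 < s) ↔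
        comb u t s ∈ nodal α V K f)) ∧
    ∃ tp sm : ℝ, 0 < tp ∧ 0 < sm ∧
      IsCritical (hFun α V K f u) (tp, sm) ∧
      (∀ t s : ℝ, 0 < t → 0 < s → IsCritical (hFun α V K f u) (t, s) → t = tp ∧ s = sm) ∧
      (∀ p ∈ quadrant, p ≠ (tp, sm) → hFun α V K f u p < hFun α V K f u (tp, sm)) ∧
      (∀ r : ℝ, 0 < r → r < tp → 0 < Phi1 α V K f u r sm * r) ∧
      (∀ r : ℝ, tp < r → Phi1 α V K f u r sm * r < 0) ∧
      (∀ r : ℝ, 0 < r → r < sm → 0 < Phi2 α V K f u tp r * r) ∧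
      (∀ r : ℝ, sm < r → Phi2 α V K f u tp r * r < 0) := by
  have hp := pos_mem_spaceX hα0 hα1 hN hV hV0 hu
  have hn := neg_mem_spaceX hα0 hα1 hN hV hV0 hu
  have hfp := (nehariNonlinearity_rayNonlinearity hα0 hα1 hN hK hK0 hf hgrowth hp hpos).1
  have hfn := (nehariNonlinearity_rayNonlinearity hα0 hα1 hN hK hK0 hf hgrowth hn hneg).1
  have hc := formX_pos_neg_nonneg (α := α) (V := V) u
  have hPhi1 := Phi1_eq_fiberPartial (K := K) (f := f) hα0 hα1 hN hV hV0 hu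
  have hPhi2 := Phi2_eq_fiberPartial (K := K) (f := f) hα0 hα1 hN hV hV0 hu
  simp only [hFun_eq_fiberMap hα0 hα1 hN hV hV0 hK hK0 hf hgrowth hu hpos hneg, hPhi1, hPhi2]
  refine ⟨fun t s _ _ => (hasFDerivAt_fiberMap _ _ _ hfp hfn t s).hasFDerivWithinAt,
    fun t s ht hs => ?_, ?_⟩
  · rw [comb_mem_nodal_iff hα0 hα1 hN hV hV0 hK hf.continuous hgrowth hu hpos hneg ht hs,
      isCritical_fiberMap_iff hfp hfn ht hs, hPhi1, hPhi2]
  obtain ⟨tp, sm, htp, hsm, hzero_p, hzero_n, hmax⟩ := exists_strict_max_fiberMap hfp hfn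
    (formX_self_pos hα0 hα1 hN hV0 hp hpos) (formX_self_pos hα0 hα1 hN hV0 hn hneg) hc
  refine ⟨tp, sm, htp, hsm, (isCritical_fiberMap_iff hfp hfn htp.le hsm.le).2 ⟨hzero_p, hzero_n⟩,
    fun t s ht hs h => ?_, hmax, fun r hr hrt => ?_, fun r hrt => ?_, fun r hr hrs => ?_,
    fun r hrs => ?_⟩
  · exact eq_of_fiberPartial_eq_zero hfp hfn hc htp hsm ht hs ⟨hzero_p, hzero_n⟩
      ((isCritical_fiberMap_iff hfp hfn ht.le hs.le).1 h)
  · exact mul_pos (fiberPartial_pos hfp hc hsm.le hzero_p hr hrt) hr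
  · exact mul_neg_of_neg_of_pos (fiberPartial_neg hfp hc htp hsm.le hzero_p hrt) (htp.trans hrt)
  · exact mul_pos (fiberPartial_pos hfn hc htp.le hzero_n hr hrs) hr
  · exact mul_neg_of_neg_of_pos (fiberPartial_neg hfn hc hsm htp.le hzero_n hrs) (hsm.trans hrs)

theorem lemma4p1 (N : ℕ) (α : ℝ) (hα0 : 0 < α) (hα1 : α < 1) (hN : 2 * α < (N : ℝ))
    (V K : Rn N → ℝ) (hVK : ClassK α V K) (f : ℝ → ℝ) (hf : CondF α V K f)
    (u : Rn N → ℝ) (hu : u ∈ spaceX α V) (hpos : Nonzero (pos u)) (hneg : Nonzero (neg u)) :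
    -- the gradient of `h^u` on the quadrant is `(Φ₁^u, Φ₂^u)`
    (∀ t s : ℝ, 0 ≤ t → 0 ≤ s →
      HasFDerivWithinAt (hFun α V K f u)
        (Phi1 α V K f u t s • ContinuousLinearMap.fst ℝ ℝ ℝ +
          Phi2 α V K f u t s • ContinuousLinearMap.snd ℝ ℝ ℝ) quadrant (t, s)) ∧
    -- (i)
    (∀ t s : ℝ, 0 ≤ t → 0 ≤ s →
      ((IsCritical (hFun α V K f u) (t, s) ∧ 0 < t ∧ 0 < s) ↔
        comb u t s ∈ nodal α V K f)) ∧
    ∃ tp sm : ℝ, 0 < tp ∧ 0 < sm ∧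
      -- (ii)
      IsCritical (hFun α V K f u) (tp, sm) ∧
      (∀ t s : ℝ, 0 < t → 0 < s → IsCritical (hFun α V K f u) (t, s) → t = tp ∧ s = sm) ∧
      (∀ p ∈ quadrant, p ≠ (tp, sm) → hFun α V K f u p < hFun α V K f u (tp, sm)) ∧
      -- (iii)
      (∀ r : ℝ, 0 < r → r < tp → 0 < Phi1 α V K f u r sm * r) ∧
      (∀ r : ℝ, tp < r → Phi1 α V K f u r sm * r < 0) ∧
      (∀ r : ℝ, 0 < r → r < sm → 0 < Phi2 α V K f u tp r * r) ∧
      (∀ r : ℝ, sm < r → Phi2 α V K f u tp r * r < 0) :=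
  lemma4p1_general N α hα0 hα1 hN V K hVK.continuous_V.aestronglyMeasurable
    (fun x => (hVK.V_pos x).le) hVK.continuous_K.aestronglyMeasurable hVK.K_pos f
    hf.nehariNonlinearity (hVK.criticalGrowth hα0 hN hf) u hu hpos hneg
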